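/- Let $B\ge 1$, let $S_0$ be a unitary $2B\times 2B$ matrix (for instance the bond-scattering matrix of a finite graph with $B$ bonds, rows and columns being indexed by directed bonds), and let $\vec L=(L_1,\dots,L_B)$ be a vector of bond lengths $L_b>0$ that are linearly independent over $\mathbb{Q}$. Put $\bar L=(L_1+\dots+L_B)/B$ and $$S(\lambda)=e^{i\lambda \vec L}S_0,\qquad e^{i\lambda\vec L}:=\mathrm{diag}\bigl(e^{i\lambda L_1},\dots,e^{i\lambda L_B},e^{i\lambda L_1},\dots,e^{i\lambda L_B}\bigr).$$ Let $0<\lambda_1\le\lambda_2\le\cdots$ be the strictly positive roots of $\det[I-S(\lambda)]=0$, repeated according to multiplicity (there are infinitely many; $\lambda_0\in\mathbb{R}$ may be chosen arbitrarily and does not influence the limit below). For each $\lambda$ let $2\pi\ge\hat\theta_1(\lambda)\ge\dots\ge\hat\theta_{2B}(\lambda)>0$ be the eigenphases of $S(\lambda)$ (so that $e^{i\hat\theta_j(\lambda)}$ are its eigenvalues with multiplicity), and let $\sigma_j(\lambda)=\hat\theta_j(\lambda)-\hat\theta_{j+1}(\lambda)$ for $1\le j<2B$ and $\sigma_{2B}(\lambda)=\hat\theta_{2B}(\lambda)+2\pi-\hat\theta_1(\lambda)$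 be the spacings between cyclically neighbouring eigenphases. Then for every continuous function $h:\mathbb{R}\to\mathbb{R}$ the limits $$P_\lambda[h]=\lim_{N\to\infty}\frac1N\sum_{n=1}^N h\bigl(\bar L(\lambda_n-\lambda_{n-1})\bigr),\qquad P_\theta[h]=\lim_{\Lambda\to\infty}\frac1\Lambda\int_0^\Lambda\frac1{2B}\sum_{j=1}^{2B}h\bigl(\sigma_j(\lambda)\bigr)\,d\lambda$$ exist, and they define bounded linear functionals of $h$: they are linear, continuous for uniform convergence on compact sets, and satisfy $|P_\lambda[h]|,|P_\theta[h]|\le\sup|h|$ whenever $h$ is bounded. Moreover, for every $\ell_0>0$ and every continuous $h$, with $S_0$ fixed, as $\vec L\to\ell_0(1,\dots,1)$ through vectors with positive entries that are linearly independent over $\mathbb{Q}$, the limits of $P_\lambda[h]$ and of $P_\theta[h]$ both exist and are equal: $$\lim_{\vec L\to\ell_0(1,\dots,1)}P_\lambda[h]=\lim_{\vec L\to\ell_0(1,\dots,1)}P_\theta[h].$$ -/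

import Mathlib

open Filter Topology MeasureTheory

noncomputable section

namespace QuantumGraph

/-- The `2B × 2B` diagonal matrix `e^{ix}`, for `x ∈ ℝ^B`. Directed bonds are indexed by
`Fin B ⊕ Fin B`; both directions of the bond `b` carry the entry `e^{i x_b}`. -/
def expDiag {B : ℕ} (x : Fin B → ℝ) : Matrix (Fin B ⊕ Fin B) (Fin B ⊕ Fin B) ℂ :=
  Matrix.diagonal (Sum.elim (fun b => Complex.exp (Complex.I * (x b : ℂ)))
    (fun b => Complex.exp (Complex.I * (x b : ℂ))))

/-- The evolution matrix `S(t) = e^{i t L} S₀`. -/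
def evolution {B : ℕ} (S₀ : Matrix (Fin B ⊕ Fin B) (Fin B ⊕ Fin B) ℂ) (L : Fin B → ℝ) (t : ℝ) :
    Matrix (Fin B ⊕ Fin B) (Fin B ⊕ Fin B) ℂ :=
  expDiag (t • L) * S₀

/-- The secular function `t ↦ det (I - e^{i t L} S₀)`, whose zeros are the `λ`-spectrum. -/
def secular {B : ℕ} (S₀ : Matrix (Fin B ⊕ Fin B) (Fin B ⊕ Fin B) ℂ) (L : Fin B → ℝ) (t : ℝ) : ℂ :=
  (1 - evolution S₀ L t).det

/-- `lam 1 ≤ lam 2 ≤ ⋯` lists the strictly positive zeros of the secular function, each one as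
often as its multiplicity. The value `lam 0` is left free. -/
structure IsLambdaSpectrum {B : ℕ} (S₀ : Matrix (Fin B ⊕ Fin B) (Fin B ⊕ Fin B) ℂ)
    (L : Fin B → ℝ) (lam : ℕ → ℝ) : Prop where
  pos : ∀ n, 1 ≤ n → 0 < lam n
  mono : ∀ m n, 1 ≤ m → m ≤ n → lam m ≤ lam n
  multiplicity : ∀ μ : ℝ, 0 < μ →
    {n : ℕ | 1 ≤ n ∧ lam n = μ}.encard = analyticOrderAt (secular S₀ L) μ

/-- The mean bond length. -/
def meanLength {B : ℕ} (L : Fin B → ℝ) : ℝ := (∑ b, L b) / B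

/-- `(1/N) ∑_{n=1}^N h (L̄ (λ_n - λ_{n-1}))`. -/
def levelSpacingMean {B : ℕ} (L : Fin B → ℝ) (lam : ℕ → ℝ) (h : ℝ → ℝ) (N : ℕ) : ℝ :=
  (1 / (N : ℝ)) * ∑ n ∈ Finset.Icc 1 N, h (meanLength L * (lam n - lam (n - 1)))

/-- The eigenphases in `(0, 2π]` of a complex matrix, with (algebraic) multiplicity, in
nonincreasing order. -/
def eigenphases {ι : Type} [Fintype ι] [DecidableEq ι] (A : Matrix ι ι ℂ) : List ℝ :=
  (A.charpoly.roots.map (fun z => toIocMod Real.two_pi_pos 0 (Complex.arg z))).sort (· ≥ ·)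

/-- The `j`-th (counted from `0`) cyclic eigenphase spacing of `A`: the difference of consecutive
eigenphases `θ̂_j - θ̂_{j+1}`, and for the last `j` the spacing `θ̂_j + 2π - θ̂_0` across `2π`. -/
def phaseSpacing {ι : Type} [Fintype ι] [DecidableEq ι] (A : Matrix ι ι ℂ) (j : ℕ) : ℝ :=
  if j + 1 < Fintype.card ι then (eigenphases A).getD j 0 - (eigenphases A).getD (j + 1) 0
  else (eigenphases A).getD j 0 + 2 * Real.pi - (eigenphases A).getD 0 0

/-- `(1/2B) ∑_{j=1}^{2B} h (σ_j)`, where the `σ_j` are the eigenphase spacings of `S(t)`. -/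
def phaseSpacingAverage {B : ℕ} (S₀ : Matrix (Fin B ⊕ Fin B) (Fin B ⊕ Fin B) ℂ)
    (L : Fin B → ℝ) (h : ℝ → ℝ) (t : ℝ) : ℝ :=
  (1 / (2 * B : ℝ)) * ∑ j ∈ Finset.range (2 * B), h (phaseSpacing (evolution S₀ L t) j)

/-- The vectors of bond lengths considered: positive and linearly independent over `ℚ`. -/
def admissibleLengths (B : ℕ) : Set (Fin B → ℝ) :=
  {L | (∀ b, 0 < L b) ∧ LinearIndependent ℚ L}

end QuantumGraph

end

/-! All eigenphases of `e^{ix} S₀`, for `x ∈ ℝ^B`, are numbered by `ℤ` as `θ x j`, continuously in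
`x` (`exists_isPhaseFamily`). Each `θ · j` is 1-Lipschitz for the sup norm, moves by exactly `c`
when every coordinate moves by `c`, and adding `2π` to one coordinate only renumbers the phases.
Averages over all spacings therefore live on the torus `(ℝ/2πℤ)^B`, and both statistics become time
averages along the linear flow `t ↦ tL`, which equidistributes when `L` is rationally independent
(`tendsto_average_of_periodic`).

For the eigenphases this is immediate: the mean of `h` over the spacings is a continuous function on
the torus, so `P_θ[h]` is its integral and does not depend on `L`.

For the levels, the multiplicity of a root is the number of phases that vanish there
(`analyticOrderAt_secular`), and each phase grows with speed between `min L` and `max L`. The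
function `flux` sums `h` of the scaled level spacings over the crossings near time `0`, weighted by
a tent of integral `1`. The tent makes it continuous on the torus, and its integral along the orbit
is the sum over the levels up to a bounded error. As the `N`-th level grows like `πN/∑ L_b`, it
follows that `P_λ[h] = (π/∑ L_b) ∫ flux` (`IsPhaseFamily.tendsto_spacingValue_mean`).

The last expression makes sense and is continuous for all positive `L`
(`IsPhaseFamily.continuousOn_integral_flux`), in particular at equal lengths. There all phases move
with the same speed, so a scaled level spacing is an eigenphase spacing, and every orbit closes up
after one turn, meeting each of the `2B` spacings once. Averaging the flux over these closed orbits
turns its torus integral into `P_θ[h]` (`IsPhaseFamily.integral_onTorus_flux_const`). -/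

noncomputable section

namespace QuantumGraph

/-! ### Orthonormal eigenvectors of unitary matrices. -/

section Spectral

/-- A linear isometry of a finite-dimensional complex inner product space has orthonormal families
of eigenvectors of every size up to the dimension. -/
theorem exists_orthonormal_eigenvectors {E : Type*} [NormedAddCommGroup E]
    [InnerProductSpace ℂ E] [FiniteDimensional ℂ E] (T : E →ₗ[ℂ] E)
    (hT : ∀ v w, inner ℂ (T v) (T w) = inner ℂ v w) (n : ℕ) (hn : n ≤ Module.finrank ℂ E) :
    ∃ (v : Fin n → E) (μ : Fin n → ℂ), Orthonormal ℂ v ∧ ∀ i, T (v i) = μ i • v i := by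
  induction n with
  | zero => exact ⟨Fin.elim0, Fin.elim0, ⟨fun i => i.elim0, fun i => i.elim0⟩, fun i => i.elim0⟩
  | succ n ih =>
    obtain ⟨v, μ, hv, hTv⟩ := ih (by omega)
    set W : Submodule ℂ E := Submodule.span ℂ (Set.range v) with hW
    have hWfin : Module.finrank ℂ W = n := by
      rw [hW, finrank_span_eq_card hv.linearIndependent, Fintype.card_fin]
    have hμ : ∀ i, μ i ≠ 0 := by
      intro i h0
      have h1 := hT (v i) (v i)
      have h2 : inner ℂ (v i) (v i) = (1 : ℂ) := by
        rw [inner_self_eq_norm_sq_to_K, hv.1 i]; simp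
      rw [hTv, h0, zero_smul, inner_zero_left, h2] at h1
      exact zero_ne_one h1
    have hmemW : ∀ w, w ∈ Wᗮ ↔ ∀ i, inner ℂ (v i) w = 0 := by
      intro w
      constructor
      · intro hw i
        exact hw _ (Submodule.subset_span ⟨i, rfl⟩)
      · intro h u hu
        induction hu using Submodule.span_induction with
        | mem x hx => obtain ⟨i, rfl⟩ := hx; exact h i
        | zero => simp
        | add x y _ _ hx hy => rw [inner_add_left, hx, hy, add_zero]
        | smul a x _ hx => rw [inner_smul_left, hx, mul_zero]
    -- An isometry preserves `⟪v i, w⟫ = 0`, and `T (v i)` is a nonzero multiple of `v i`; so the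
    -- next eigenvector can be sought in `Wᗮ`.
    have hinv : ∀ w ∈ Wᗮ, T w ∈ Wᗮ := by
      intro w hw
      rw [hmemW] at hw ⊢
      intro i
      have h1 := hT (v i) w
      rw [hTv, inner_smul_left, hw i] at h1
      exact (mul_eq_zero.1 h1).resolve_left (by simpa using hμ i)
    have hpos : 0 < Module.finrank ℂ (Wᗮ : Submodule ℂ E) := by
      have := Submodule.finrank_add_finrank_orthogonal W
      omega
    have : Nontrivial (Wᗮ : Submodule ℂ E) := Module.finrank_pos_iff.1 hpos
    obtain ⟨c, hc⟩ := Module.End.exists_eigenvalue (T.restrict hinv)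
    obtain ⟨u, hu⟩ := hc.exists_hasEigenvector
    have hu0 : (u : E) ≠ 0 := fun h => hu.2 (Subtype.ext h)
    have hTu : T (u : E) = c • (u : E) := by
      have := congrArg Subtype.val hu.apply_eq_smul
      simpa using this
    set e : E := ((‖(u : E)‖⁻¹ : ℝ) : ℂ) • (u : E) with he
    have he1 : ‖e‖ = 1 := by
      rw [he, norm_smul]
      simp [hu0]
    have heW : ∀ i, inner ℂ (v i) e = 0 := by
      intro i
      rw [he, inner_smul_right, (hmemW u).1 u.2 i, mul_zero]
    refine ⟨Fin.cons e v, Fin.cons c μ, ⟨?_, ?_⟩, ?_⟩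
    · intro i
      refine Fin.cases ?_ (fun i => ?_) i
      · simpa using he1
      · simpa using hv.1 i
    · intro i j
      refine Fin.cases ?_ (fun i => ?_) i <;> refine Fin.cases ?_ (fun j => ?_) j
      · intro h; exact absurd rfl h
      · intro _
        simp only [Fin.cons_zero, Fin.cons_succ]
        rw [← inner_conj_symm, heW, map_zero]
      · intro _
        simpa using heW i
      · intro h
        simpa using hv.2 (fun h' => h (congrArg Fin.succ h'))
    · intro i
      refine Fin.cases ?_ (fun i => ?_) i
      · simp only [Fin.cons_zero]
        rw [he, map_smul, hTu, smul_comm]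
      · simpa using hTv i

/-- Two finite families with the same multiset of values differ by a bijection of the indices. -/
theorem exists_equiv_of_map_univ_eq {α β γ : Type*} [Fintype α] [Fintype β] [DecidableEq γ]
    {f : α → γ} {g : β → γ}
    (h : (Finset.univ : Finset α).val.map f = (Finset.univ : Finset β).val.map g) :
    ∃ σ : α ≃ β, ∀ a, g (σ a) = f a := by
  have hcard : ∀ z, Fintype.card {a // f a = z} = Fintype.card {b // g b = z} := by
    intro z
    have h1 := congrArg (Multiset.count z) h
    rw [Multiset.count_map, Multiset.count_map] at h1
    rw [Fintype.card_subtype, Fintype.card_subtype, Finset.card_def, Finset.card_def,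
      Finset.filter_val, Finset.filter_val]
    simpa only [eq_comm] using h1
  refine ⟨(Equiv.sigmaFiberEquiv f).symm.trans ((Equiv.sigmaCongrRight
    fun z => Fintype.equivOfCardEq (hcard z)).trans (Equiv.sigmaFiberEquiv g)), fun a => ?_⟩
  exact (Fintype.equivOfCardEq (hcard (f a)) ⟨a, rfl⟩).2

variable {ι : Type} [Fintype ι] [DecidableEq ι]

theorem inner_toEuclideanLin_of_mem_unitaryGroup {A : Matrix ι ι ℂ}
    (hA : A ∈ Matrix.unitaryGroup ι ℂ) (v w : EuclideanSpace ℂ ι) :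
    inner ℂ (Matrix.toEuclideanLin A v) (Matrix.toEuclideanLin A w) = inner ℂ v w := by
  rw [← LinearMap.adjoint_inner_right, ← Matrix.toEuclideanLin_conjTranspose_eq_adjoint]
  have h : A.conjTranspose * A = 1 := Matrix.mem_unitaryGroup_iff'.1 hA
  congr 1
  rw [← LinearMap.comp_apply, ← Matrix.toLpLin_mul_same, h, Matrix.toLpLin_one]
  rfl

theorem norm_toEuclideanLin_of_mem_unitaryGroup {A : Matrix ι ι ℂ}
    (hA : A ∈ Matrix.unitaryGroup ι ℂ) (v : EuclideanSpace ℂ ι) :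
    ‖Matrix.toEuclideanLin A v‖ = ‖v‖ := by
  have h := inner_toEuclideanLin_of_mem_unitaryGroup hA v v
  rw [inner_self_eq_norm_sq_to_K, inner_self_eq_norm_sq_to_K] at h
  have h' : ‖Matrix.toEuclideanLin A v‖ ^ 2 = ‖v‖ ^ 2 := by exact_mod_cast h
  exact (pow_left_inj₀ (norm_nonneg _) (norm_nonneg _) two_ne_zero).1 h'

/-- A unitary matrix has an orthonormal basis of eigenvectors, in any prescribed ordering of the
roots of the characteristic polynomial. -/
theorem exists_orthonormal_eigenvectors_of_roots {A : Matrix ι ι ℂ}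
    (hA : A ∈ Matrix.unitaryGroup ι ℂ) {z : Fin (Fintype.card ι) → ℂ}
    (hz : A.charpoly.roots = (Finset.univ : Finset (Fin (Fintype.card ι))).val.map z) :
    ∃ v : Fin (Fintype.card ι) → EuclideanSpace ℂ ι, Orthonormal ℂ v ∧
      ∀ i, Matrix.toEuclideanLin A (v i) = z i • v i := by
  classical
  obtain ⟨v, μ, hv, hμ⟩ := exists_orthonormal_eigenvectors (Matrix.toEuclideanLin A)
    (inner_toEuclideanLin_of_mem_unitaryGroup hA) (Fintype.card ι) (by simp)
  have hspan : ⊤ ≤ Submodule.span ℂ (Set.range v) := by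
    rw [top_le_iff]
    apply Submodule.eq_top_of_finrank_eq
    rw [finrank_span_eq_card hv.linearIndependent]
    simp
  let b := Module.Basis.mk hv.linearIndependent hspan
  have hb : ∀ i, b i = v i := fun i => Module.Basis.mk_apply _ _ i
  have hmat : LinearMap.toMatrix b b (Matrix.toEuclideanLin A) = Matrix.diagonal μ := by
    ext i j
    rw [LinearMap.toMatrix_apply, hb, hμ, ← hb, map_smul, Module.Basis.repr_self,
      Matrix.diagonal_apply]
    simp only [Finsupp.smul_apply, Finsupp.single_apply, smul_eq_mul, mul_ite, mul_one, mul_zero]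
    by_cases h : i = j
    · simp [h]
    · simp [h, Ne.symm h]
  have hchar : A.charpoly = ∏ i, (Polynomial.X - Polynomial.C (μ i)) := by
    rw [← Matrix.charpoly_diagonal, ← hmat, LinearMap.charpoly_toMatrix,
      Matrix.toEuclideanLin, Matrix.toLpLin_eq_toLin, ← LinearMap.charpoly_toMatrix _ (PiLp.basisFun 2 ℂ ι),
      LinearMap.toMatrix_toLin]
  have hroots : A.charpoly.roots = (Finset.univ : Finset (Fin (Fintype.card ι))).val.map μ := by
    rw [hchar, ← Polynomial.roots_multiset_prod_X_sub_C (Finset.univ.val.map μ), Multiset.map_map]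
    rfl
  obtain ⟨σ, hσ⟩ := exists_equiv_of_map_univ_eq (hz.symm.trans hroots)
  exact ⟨v ∘ σ, hv.comp σ σ.injective, fun i => by simp [hμ, hσ]⟩

end Spectral

/-! ### Periodic and quasiperiodic sequences indexed by `ℤ`. -/

section IntegerSequences

theorem sum_range_int_shift {M : Type*} [AddCommMonoid M] (f : ℤ → M) (m : ℕ) (k : ℤ) :
    ∑ j ∈ Finset.range m, f (j + (k + 1)) + f k = ∑ j ∈ Finset.range m, f (j + k) + f (k + m) := by
  have h := Finset.sum_range_succ (fun j : ℕ => f (j + k)) m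
  rw [Finset.sum_range_succ'] at h
  simp only [Nat.cast_add, Nat.cast_one, Nat.cast_zero, zero_add] at h
  rw [add_comm k (m : ℤ), ← h]
  congr 1
  exact Finset.sum_congr rfl fun j _ => by congr 1; ring

theorem sum_range_int_shift_of_periodic {M : Type*} [AddCancelCommMonoid M] {f : ℤ → M} {m : ℕ}
    (hf : ∀ j, f (j + m) = f j) (k : ℤ) :
    ∑ j ∈ Finset.range m, f (j + k) = ∑ j ∈ Finset.range m, f j := by
  have step : ∀ k : ℤ, ∑ j ∈ Finset.range m, f (j + (k + 1)) = ∑ j ∈ Finset.range m, f (j + k) := by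
    intro k
    have h := sum_range_int_shift f m k
    rw [hf] at h
    exact add_right_cancel h
  induction k using Int.induction_on with
  | zero => simp
  | succ k ih => rw [step, ih]
  | pred k ih => rw [← step, sub_add_cancel, ih]

/-- Moving the window by one replaces `f k` by `f (k + m) = f k + c`. This is why the sum over one
period fixes the numbering of a phase lift. -/
theorem sum_range_int_shift_of_quasiperiodic {f : ℤ → ℝ} {m : ℕ} {c : ℝ}
    (hf : ∀ j, f (j + m) = f j + c) (k : ℤ) :
    ∑ j ∈ Finset.range m, f (j + k) = ∑ j ∈ Finset.range m, f j + k * c := by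
  have step : ∀ k : ℤ,
      ∑ j ∈ Finset.range m, f (j + (k + 1)) = ∑ j ∈ Finset.range m, f (j + k) + c := by
    intro k
    have h := sum_range_int_shift f m k
    rw [hf] at h
    linarith
  induction k using Int.induction_on with
  | zero => simp
  | succ k ih => rw [step, ih]; push_cast; ring
  | pred k ih =>
    have h := step (-(k : ℤ) - 1)
    rw [sub_add_cancel, ih] at h
    push_cast at h ⊢
    linarith

theorem quasiperiodic_mul {f : ℤ → ℝ} {m : ℕ} {c : ℝ} (hf : ∀ j, f (j + m) = f j + c)
    (j q : ℤ) : f (j + q * m) = f j + q * c := by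
  induction q using Int.induction_on with
  | zero => simp
  | succ k ih =>
    rw [show j + ((k : ℤ) + 1) * m = j + k * m + m by ring, hf, ih]; push_cast; ring
  | pred k ih =>
    have h := hf (j + (-(k : ℤ) - 1) * m)
    rw [show j + (-(k : ℤ) - 1) * m + m = j + (-k) * m by ring, ih] at h
    push_cast at h ⊢
    linarith

end IntegerSequences

/-! ### Angles between vectors of a complex inner product space. -/

section Angles

variable {E : Type*} [NormedAddCommGroup E] [InnerProductSpace ℂ E]

/-- The triangle inequality for angles between vectors of equal norm. -/
theorem cos_add_mul_sq_le_re_inner {x y z : E} {r w ε : ℝ} (hr : 0 < r) (hx : ‖x‖ = r)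
    (hy : ‖y‖ = r) (hz : ‖z‖ = r) (hw : 0 ≤ w) (hε : 0 ≤ ε) (hwε : w + ε ≤ Real.pi)
    (hxy : Real.cos w * r ^ 2 ≤ (inner ℂ x y).re) (hyz : Real.cos ε * r ^ 2 ≤ (inner ℂ y z).re) :
    Real.cos (w + ε) * r ^ 2 ≤ (inner ℂ x z).re := by
  -- The real part of the complex inner product is a real inner product, for which angles satisfy
  -- the triangle inequality.
  let _ : InnerProductSpace ℝ E := InnerProductSpace.rclikeToReal ℂ E
  have key : ∀ {u v : E} {t : ℝ}, ‖u‖ = r → ‖v‖ = r → 0 ≤ t → t ≤ Real.pi →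
      (InnerProductGeometry.angle u v ≤ t ↔ Real.cos t * r ^ 2 ≤ (inner ℂ u v).re) := by
    intro u v t hu hv ht ht'
    have h1 : inner ℝ u v = (inner ℂ u v).re := rfl
    have h2 := InnerProductGeometry.cos_angle u v
    rw [hu, hv, h1] at h2
    have h3 : (inner ℂ u v).re = Real.cos (InnerProductGeometry.angle u v) * r ^ 2 := by
      rw [h2]; field_simp
    rw [h3, mul_le_mul_iff_left₀ (by positivity)]
    exact (Real.strictAntiOn_cos.le_iff_ge ⟨ht, ht'⟩
      ⟨InnerProductGeometry.angle_nonneg u v, InnerProductGeometry.angle_le_pi u v⟩).symm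
  rw [← key hx hz (by positivity) hwε]
  have a1 := (key hx hy hw (by linarith)).2 hxy
  have a2 := (key hy hz hε (by linarith)).2 hyz
  linarith [InnerProductGeometry.angle_le_angle_add_angle x y z]

theorem norm_sq_of_orthonormal_sum {n : ℕ} {u : Fin n → E} (hu : Orthonormal ℂ u)
    (a : Fin n → ℂ) : ‖∑ i, a i • u i‖ ^ 2 = ∑ i, ‖a i‖ ^ 2 := by
  have h := hu.inner_sum a a Finset.univ
  rw [inner_self_eq_norm_sq_to_K] at h
  have h2 : ((‖∑ i, a i • u i‖ ^ 2 : ℝ) : ℂ) = ((∑ i, ‖a i‖ ^ 2 : ℝ) : ℂ) := by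
    push_cast
    refine h.trans (Finset.sum_congr rfl fun i _ => ?_)
    exact Complex.conj_mul' (a i)
  exact_mod_cast h2

/-- Cross terms vanish. The angle between `e^{ic} v` and `T v` is thus controlled by how far the
phases present in `v` lie from `c`, from above and from below. -/
theorem re_inner_of_orthonormal_eigenvectors {n : ℕ} {u : Fin n → E} (hu : Orthonormal ℂ u)
    {T : E →ₗ[ℂ] E} {α : Fin n → ℝ}
    (hT : ∀ i, T (u i) = Complex.exp (Complex.I * (α i : ℂ)) • u i) (c : ℝ) (a : Fin n → ℂ) :
    (inner ℂ (Complex.exp (Complex.I * (c : ℂ)) • ∑ i, a i • u i) (T (∑ i, a i • u i))).re =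
      ∑ i, ‖a i‖ ^ 2 * Real.cos (α i - c) := by
  have h1 : Complex.exp (Complex.I * (c : ℂ)) • ∑ i, a i • u i =
      ∑ i, (Complex.exp (Complex.I * (c : ℂ)) * a i) • u i := by
    simp only [Finset.smul_sum, smul_smul]
  have h2 : T (∑ i, a i • u i) = ∑ i, (Complex.exp (Complex.I * (α i : ℂ)) * a i) • u i := by
    simp only [map_sum, map_smul, hT, smul_smul, mul_comm]
  rw [h1, h2, hu.inner_sum, Complex.re_sum]
  refine Finset.sum_congr rfl fun i _ => ?_
  have h3 : (starRingEnd ℂ) (Complex.exp (Complex.I * (c : ℂ)) * a i) *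
      (Complex.exp (Complex.I * (α i : ℂ)) * a i) =
      ((‖a i‖ ^ 2 : ℝ) : ℂ) * Complex.exp (((α i - c : ℝ) : ℂ) * Complex.I) := by
    rw [map_mul, ← Complex.exp_conj, map_mul, Complex.conj_I, Complex.conj_ofReal]
    push_cast
    rw [← Complex.conj_mul' (a i), show ((α i : ℂ) - c) * Complex.I =
      -Complex.I * c + Complex.I * α i by ring, Complex.exp_add]
    ring
  rw [h3, Complex.re_ofReal_mul, Complex.exp_ofReal_mul_I_re]

end Angles

/-! ### Lifts of the eigenphases to `ℤ`, and the counting inequality for two nearby unitary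
matrices. -/

section Lift

variable {ι : Type} [Fintype ι] [DecidableEq ι]

/-- `θ` lists all real numbers whose exponentials are eigenvalues of `A`, in nondecreasing order
and with multiplicity. -/
structure IsPhaseLift (A : Matrix ι ι ℂ) (θ : ℤ → ℝ) : Prop where
  mono : Monotone θ
  period : ∀ j, θ (j + Fintype.card ι) = θ j + 2 * Real.pi
  roots : A.charpoly.roots = ∑ j ∈ Finset.range (Fintype.card ι),
    {Complex.exp (Complex.I * (θ j : ℂ))}

theorem exp_I_mul_add_two_pi (x : ℝ) :
    Complex.exp (Complex.I * ((x + 2 * Real.pi : ℝ) : ℂ)) = Complex.exp (Complex.I * (x : ℂ)) := by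
  push_cast
  rw [mul_add, Complex.exp_add, show Complex.I * (2 * (Real.pi : ℂ)) = 2 * Real.pi * Complex.I by
    ring, Complex.exp_two_pi_mul_I, mul_one]

theorem IsPhaseLift.shift {A : Matrix ι ι ℂ} {θ : ℤ → ℝ} (h : IsPhaseLift A θ) (k : ℤ) :
    IsPhaseLift A (fun j => θ (j + k)) := by
  refine ⟨fun i j hij => h.mono (by simpa using hij), fun j => ?_, ?_⟩
  · rw [← h.period]; congr 1; ring
  · rw [h.roots]
    refine (sum_range_int_shift_of_periodic
      (f := fun j : ℤ => ({Complex.exp (Complex.I * (θ j : ℂ))} : Multiset ℂ)) (fun j => ?_) k).symm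
    rw [h.period, exp_I_mul_add_two_pi]

theorem IsPhaseLift.exists_eigenvectors {A : Matrix ι ι ℂ} (hA : A ∈ Matrix.unitaryGroup ι ℂ)
    {θ : ℤ → ℝ} (h : IsPhaseLift A θ) {n : ℕ} (hn : n ≤ Fintype.card ι) :
    ∃ v : Fin n → EuclideanSpace ℂ ι, Orthonormal ℂ v ∧
      ∀ i : Fin n, Matrix.toEuclideanLin A (v i) =
        Complex.exp (Complex.I * (θ ((i : ℕ) : ℤ) : ℂ)) • v i := by
  have hroots := h.roots
  rw [Finset.sum_range] at hroots
  obtain ⟨v, hv, hv'⟩ := exists_orthonormal_eigenvectors_of_roots hA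
    (hroots.trans (Multiset.bind_singleton _ _))
  exact ⟨v ∘ Fin.castLE hn, hv.comp _ (Fin.castLE_injective hn), fun i => by simp [hv']⟩

/-- If two unitary matrices move vectors to directions that differ by at most the angle `ε`, then
widening an arc by `ε` on both sides does not decrease the number of eigenphases in it. -/
theorem IsPhaseLift.not_lt_and_lt {A A' : Matrix ι ι ℂ} (hA : A ∈ Matrix.unitaryGroup ι ℂ)
    (hA' : A' ∈ Matrix.unitaryGroup ι ℂ) {α β : ℤ → ℝ} (hα : IsPhaseLift A α)
    (hβ : IsPhaseLift A' β) {ε : ℝ} (hε : 0 ≤ ε)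
    (hclose : ∀ v, Real.cos ε * ‖v‖ ^ 2 ≤
      (inner ℂ (Matrix.toEuclideanLin A v) (Matrix.toEuclideanLin A' v)).re)
    (i j : ℤ) (n : ℕ) (hn : α (j + n) - α j + 2 * ε < 2 * Real.pi) :
    ¬ (β i < α j - ε ∧ α (j + n) + ε < β (i + (n + 1))) := by
  rintro ⟨h1, h2⟩
  -- A run of more than `Fintype.card ι` phases would span at least `2π`.
  have hnm : n + 1 ≤ Fintype.card ι := by
    by_contra hcon
    have : α (j + Fintype.card ι) ≤ α (j + n) := hα.mono (by omega)
    rw [hα.period] at this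
    linarith
  have hab : α j ≤ α (j + n) := hα.mono (by omega)
  -- The `n + 1` eigenvectors `u` of `A` have phases in the arc from `α j` to `α (j + n)`, with
  -- centre `c` and half-width `d`. The `card - n` eigenvectors `w` of `A'` have phases from `β (i +
  -- n + 1)` to `β i + 2π`, all outside the widened arc. The dimensions exceed the total by one, so
  -- the spans share some `v ≠ 0`; then `A v` is within angle `d` of `e^{ic} v`, while `A' v` is
  -- farther than `d + ε` from it.
  obtain ⟨u, hu, hAu⟩ := (hα.shift j).exists_eigenvectors hA hnm
  obtain ⟨w, hw, hAw⟩ := (hβ.shift (i + (n + 1))).exists_eigenvectors hA'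
    (Nat.sub_le (Fintype.card ι) n)
  set c : ℝ := (α j + α (j + n)) / 2 with hc
  set d : ℝ := (α (j + n) - α j) / 2 with hd
  have hndisj : ¬ Disjoint (Submodule.span ℂ (Set.range u)) (Submodule.span ℂ (Set.range w)) := by
    intro hdis
    have := Submodule.finrank_add_finrank_le_of_disjoint hdis
    rw [finrank_span_eq_card hu.linearIndependent, finrank_span_eq_card hw.linearIndependent,
      Fintype.card_fin, Fintype.card_fin, finrank_euclideanSpace] at this
    omega
  rw [Submodule.disjoint_def] at hndisj
  push Not at hndisj
  obtain ⟨v, hvu, hvw, hv0⟩ := hndisj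
  obtain ⟨a, rfl⟩ := (Submodule.mem_span_range_iff_exists_fun ℂ).1 hvu
  obtain ⟨b, hb⟩ := (Submodule.mem_span_range_iff_exists_fun ℂ).1 hvw
  set v := ∑ i, a i • u i with hv
  have hA1 : Real.cos d * ‖v‖ ^ 2 ≤
      (inner ℂ (Complex.exp (Complex.I * (c : ℂ)) • v) (Matrix.toEuclideanLin A v)).re := by
    rw [hv, re_inner_of_orthonormal_eigenvectors hu hAu, norm_sq_of_orthonormal_sum hu,
      Finset.mul_sum]
    refine Finset.sum_le_sum fun k _ => ?_
    rw [mul_comm]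
    refine mul_le_mul_of_nonneg_left ?_ (by positivity)
    have hk1 : α j ≤ α ((k : ℕ) + j) := hα.mono (by omega)
    have hk2 : α ((k : ℕ) + j) ≤ α (j + n) := hα.mono (by have := k.2; omega)
    rw [← Real.cos_abs (α ((k : ℕ) + j) - c)]
    apply Real.cos_le_cos_of_nonneg_of_le_pi (abs_nonneg _) (by linarith)
    rw [abs_le]
    constructor <;> linarith
  have hA2 : (inner ℂ (Complex.exp (Complex.I * (c : ℂ)) • v) (Matrix.toEuclideanLin A' v)).re <
      Real.cos (d + ε) * ‖v‖ ^ 2 := by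
    rw [← hb, re_inner_of_orthonormal_eigenvectors hw hAw, norm_sq_of_orthonormal_sum hw,
      Finset.mul_sum]
    have hcos : ∀ k : Fin (Fintype.card ι - n),
        Real.cos (β ((k : ℕ) + (i + (n + 1))) - c) < Real.cos (d + ε) := by
      intro k
      have hk1 : β (i + (n + 1)) ≤ β ((k : ℕ) + (i + (n + 1))) := hβ.mono (by omega)
      have hk2 : β ((k : ℕ) + (i + (n + 1))) ≤ β (i + Fintype.card ι) :=
        hβ.mono (by have := k.2; omega)
      rw [hβ.period] at hk2
      rcases le_total (β ((k : ℕ) + (i + (n + 1))) - c) Real.pi with hp | hp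
      · exact Real.cos_lt_cos_of_nonneg_of_le_pi (by linarith) hp (by linarith)
      · rw [← Real.cos_two_pi_sub (β ((k : ℕ) + (i + (n + 1))) - c)]
        exact Real.cos_lt_cos_of_nonneg_of_le_pi (by linarith) (by linarith) (by linarith)
    have hbne : ∃ k, b k ≠ 0 := by
      by_contra hcon
      push Not at hcon
      apply hv0
      rw [← hb]
      simp [hcon]
    obtain ⟨k, hk⟩ := hbne
    refine Finset.sum_lt_sum (fun k _ => ?_) ⟨k, Finset.mem_univ k, ?_⟩
    · rw [mul_comm]
      exact mul_le_mul_of_nonneg_right (hcos k).le (by positivity)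
    · rw [mul_comm]
      exact mul_lt_mul_of_pos_right (hcos k) (by positivity)
  have hfin := cos_add_mul_sq_le_re_inner (norm_pos_iff.2 hv0)
    (by rw [norm_smul, mul_comm Complex.I, Complex.norm_exp_ofReal_mul_I, one_mul])
    (norm_toEuclideanLin_of_mem_unitaryGroup hA v) (norm_toEuclideanLin_of_mem_unitaryGroup hA' v)
    (by linarith) hε (by linarith) hA1 (hclose v)
  linarith

end Lift

/-! ### Perturbation of phase lifts and uniqueness of the numbering. -/

section Lift

variable {ι : Type} [Fintype ι] [DecidableEq ι]

/-- The gaps of one period add up to `2π`, so one is at least the average. Starting the comparison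
of two spectra behind such a gap keeps the widened arcs shorter than a full turn. -/
theorem IsPhaseLift.exists_gap [Nonempty ι] {A : Matrix ι ι ℂ} {θ : ℤ → ℝ}
    (h : IsPhaseLift A θ) : ∃ j, 2 * Real.pi / Fintype.card ι ≤ θ (j + 1) - θ j := by
  have hm : (0 : ℝ) < Fintype.card ι := by exact_mod_cast Fintype.card_pos
  by_contra! hcon
  have h1 : ∑ j ∈ Finset.range (Fintype.card ι), (θ ((j : ℤ) + 1) - θ j) = 2 * Real.pi := by
    have := Finset.sum_range_sub (fun j : ℕ => θ j) (Fintype.card ι)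
    have h2 := h.period 0
    simp only [Nat.cast_add, Nat.cast_one, Nat.cast_zero] at this
    rw [this]
    rw [zero_add] at h2
    linarith
  have h3 : ∑ j ∈ Finset.range (Fintype.card ι), (θ ((j : ℤ) + 1) - θ j) <
      ∑ j ∈ Finset.range (Fintype.card ι), 2 * Real.pi / Fintype.card ι :=
    Finset.sum_lt_sum_of_nonempty (by simp [Fintype.card_ne_zero]) fun j _ => hcon j
  rw [h1, Finset.sum_const, Finset.card_range, nsmul_eq_mul, mul_div_cancel₀ _ hm.ne'] at h3
  exact lt_irrefl _ h3

theorem IsPhaseLift.sub_le_of_forall_range [Nonempty ι] {A A' : Matrix ι ι ℂ} {α β : ℤ → ℝ}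
    (hα : IsPhaseLift A α) (hβ : IsPhaseLift A' β) {i j : ℤ} {ε : ℝ}
    (h : ∀ n : ℕ, n < Fintype.card ι → α (j + n) - β (i + n) ≤ ε) (l : ℤ) :
    α l - β (l + (i - j)) ≤ ε := by
  have hm : (0 : ℤ) < Fintype.card ι := by exact_mod_cast Fintype.card_pos
  obtain ⟨n, hn⟩ := Int.eq_ofNat_of_zero_le (Int.emod_nonneg (l - j) hm.ne')
  have hlt := Int.emod_lt_of_pos (l - j) hm
  have hdiv := Int.emod_add_mul_ediv (l - j) (Fintype.card ι)
  have h1 := quasiperiodic_mul hα.period (j + n) ((l - j) / (Fintype.card ι : ℤ))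
  have h2 := quasiperiodic_mul hβ.period (i + n) ((l - j) / (Fintype.card ι : ℤ))
  have e1 : l = j + n + (l - j) / (Fintype.card ι : ℤ) * (Fintype.card ι : ℤ) := by
    linarith
  have e2 : l + (i - j) = i + n + (l - j) / (Fintype.card ι : ℤ) * (Fintype.card ι : ℤ) := by
    linarith
  rw [e2, h2]
  nth_rw 1 [e1]
  rw [h1]
  linarith [h n (by omega)]

/-- Eigenphases of nearby unitary matrices are close to each other, after a shift of the
numbering. -/
theorem IsPhaseLift.exists_shift_abs_sub_le [Nonempty ι] {A A' : Matrix ι ι ℂ}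
    (hA : A ∈ Matrix.unitaryGroup ι ℂ) (hA' : A' ∈ Matrix.unitaryGroup ι ℂ) {α β : ℤ → ℝ}
    (hα : IsPhaseLift A α) (hβ : IsPhaseLift A' β) {ε : ℝ} (hε : 0 ≤ ε)
    (hεm : 4 * ε < 2 * Real.pi / Fintype.card ι)
    (hclose : ∀ v, Real.cos ε * ‖v‖ ^ 2 ≤
      (inner ℂ (Matrix.toEuclideanLin A v) (Matrix.toEuclideanLin A' v)).re) :
    ∃ k : ℤ, ∀ l, |α l - β (l + k)| ≤ ε := by
  have hclose' : ∀ v, Real.cos ε * ‖v‖ ^ 2 ≤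
      (inner ℂ (Matrix.toEuclideanLin A' v) (Matrix.toEuclideanLin A v)).re := by
    intro v
    rw [← inner_conj_symm, Complex.conj_re]
    exact hclose v
  have hm : (0 : ℤ) < Fintype.card ι := by exact_mod_cast Fintype.card_pos
  obtain ⟨j, hj⟩ := hα.exists_gap
  have hbdd : ∃ b : ℤ, ∀ z : ℤ, β z < α (j + 1) - ε → z ≤ b := by
    obtain ⟨q, hq⟩ := exists_nat_ge ((α (j + 1) - ε - β 0) / (2 * Real.pi))
    refine ⟨q * Fintype.card ι, fun z hz => ?_⟩
    by_contra! hcon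
    have h1 := hβ.mono hcon.le
    have h2 := quasiperiodic_mul hβ.period 0 q
    rw [zero_add] at h2
    rw [h2] at h1
    rw [div_le_iff₀ Real.two_pi_pos] at hq
    push_cast at h1
    linarith
  have hinh : ∃ z : ℤ, β z < α (j + 1) - ε := by
    obtain ⟨q, hq⟩ := exists_nat_gt (-(α (j + 1) - ε - β 0) / (2 * Real.pi))
    refine ⟨(-q : ℤ) * Fintype.card ι, ?_⟩
    have h2 := quasiperiodic_mul hβ.period 0 (-q : ℤ)
    rw [zero_add] at h2
    rw [h2]
    rw [div_lt_iff₀ Real.two_pi_pos] at hq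
    push_cast
    linarith
  -- Since `i` is the last index of `β` below the widened gap end `α (j + 1) - ε`, the indices `i +
  -- 1` and `j + 1` are matched.
  obtain ⟨i, hi, hmax⟩ := Int.exists_greatest_of_bdd hbdd hinh
  have hi' : α (j + 1) - ε ≤ β (i + 1) := by
    by_contra! hcon
    have := hmax _ hcon
    omega
  have hper : α (j + Fintype.card ι) = α j + 2 * Real.pi := hα.period j
  have up : ∀ n : ℕ, n < Fintype.card ι → β (i + 1 + n) - α (j + 1 + n) ≤ ε := by
    intro n hn
    have hle : α (j + 1 + n) ≤ α (j + Fintype.card ι) := hα.mono (by omega)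
    have := hα.not_lt_and_lt hA hA' hβ hε hclose i (j + 1) n (by linarith)
    push Not at this
    have := this hi
    rw [show i + 1 + (n : ℤ) = i + (n + 1) by ring]
    linarith
  have hβper : β (i + Fintype.card ι) = β i + 2 * Real.pi := hβ.period i
  -- This is the upper bound for the last index of the period. Hence the gap of `β` after `i` is at
  -- least that of `α` after `j` minus `2ε`, and the roles can be exchanged; another `2ε` for
  -- widening the arcs accounts for the `4 * ε` in the hypothesis.
  have hβi : β i ≤ α j + ε := by
    have h1 := up (Fintype.card ι - 1) (by omega)
    rw [show i + 1 + ((Fintype.card ι - 1 : ℕ) : ℤ) = i + Fintype.card ι by omega,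
      show j + 1 + ((Fintype.card ι - 1 : ℕ) : ℤ) = j + Fintype.card ι by omega] at h1
    linarith
  have down : ∀ n : ℕ, n < Fintype.card ι → α (j + 1 + n) - β (i + 1 + n) ≤ ε := by
    intro n hn
    have hle : β (i + 1 + n) ≤ β (i + Fintype.card ι) := hβ.mono (by omega)
    have := hβ.not_lt_and_lt hA' hA hα hε hclose' j (i + 1) n (by linarith)
    push Not at this
    have := this (by linarith)
    rw [show j + 1 + (n : ℤ) = j + (n + 1) by ring]
    linarith
  refine ⟨i + 1 - (j + 1), fun l => abs_le.2 ⟨?_, ?_⟩⟩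
  · have := hβ.sub_le_of_forall_range hα up (l + (i + 1 - (j + 1)))
    rw [show l + (i + 1 - (j + 1)) + (j + 1 - (i + 1)) = l by ring] at this
    linarith
  · exact hα.sub_le_of_forall_range hβ down l

/-- Eigenphases of nearby unitary matrices are close to each other if they are numbered in such a
way that their sums are close. -/
theorem IsPhaseLift.abs_sub_le [Nonempty ι] {A A' : Matrix ι ι ℂ}
    (hA : A ∈ Matrix.unitaryGroup ι ℂ) (hA' : A' ∈ Matrix.unitaryGroup ι ℂ) {α β : ℤ → ℝ}
    (hα : IsPhaseLift A α) (hβ : IsPhaseLift A' β) {ε : ℝ} (hε : 0 ≤ ε)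
    (hεm : 4 * ε < 2 * Real.pi / Fintype.card ι)
    (hclose : ∀ v, Real.cos ε * ‖v‖ ^ 2 ≤
      (inner ℂ (Matrix.toEuclideanLin A v) (Matrix.toEuclideanLin A' v)).re)
    (hsum : |∑ j ∈ Finset.range (Fintype.card ι), α j - ∑ j ∈ Finset.range (Fintype.card ι), β j| ≤
      Fintype.card ι * ε) (l : ℤ) :
    |α l - β l| ≤ ε := by
  obtain ⟨k, hk⟩ := hα.exists_shift_abs_sub_le hA hA' hβ hε hεm hclose
  have hm : (0 : ℝ) < Fintype.card ι := by exact_mod_cast Fintype.card_pos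
  rw [lt_div_iff₀ hm] at hεm
  -- A shift by `k` changes the sum over one period by `2πk`, but the two bounds allow a change of
  -- at most `2 * card * ε < π`.
  suffices hk0 : k = 0 by simpa [hk0] using hk l
  have h1 : |∑ j ∈ Finset.range (Fintype.card ι), (α j - β (j + k))| ≤ Fintype.card ι * ε := by
    refine (Finset.abs_sum_le_sum_abs _ _).trans ((Finset.sum_le_sum fun (j : ℕ) _ => hk j).trans ?_)
    simp
  rw [Finset.sum_sub_distrib, sum_range_int_shift_of_quasiperiodic hβ.period] at h1
  rw [abs_le] at h1 hsum
  have h2 : (k : ℝ) < 1 := by nlinarith [Real.pi_pos]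
  have h3 : (-1 : ℝ) < k := by nlinarith [Real.pi_pos]
  have h4 : k < 1 := by exact_mod_cast h2
  have h5 : -1 < k := by exact_mod_cast h3
  omega

/-- This is the comparison of `A` with itself for `ε = 0`. -/
theorem IsPhaseLift.exists_eq_shift [Nonempty ι] {A : Matrix ι ι ℂ}
    (hA : A ∈ Matrix.unitaryGroup ι ℂ) {α β : ℤ → ℝ} (hα : IsPhaseLift A α)
    (hβ : IsPhaseLift A β) : ∃ k : ℤ, ∀ l, α l = β (l + k) := by
  have hm : (0 : ℝ) < Fintype.card ι := by exact_mod_cast Fintype.card_pos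
  obtain ⟨k, hk⟩ := hα.exists_shift_abs_sub_le hA hA hβ le_rfl
    (by have := Real.pi_pos; simp only [mul_zero]; positivity) (fun v => by
      rw [inner_self_eq_norm_sq_to_K, norm_toEuclideanLin_of_mem_unitaryGroup hA]
      simp [← Complex.ofReal_pow])
  exact ⟨k, fun l => sub_eq_zero.1 (abs_eq_zero.1 (le_antisymm (hk l) (abs_nonneg _)))⟩

theorem IsPhaseLift.eq_of_sum_eq [Nonempty ι] {A : Matrix ι ι ℂ}
    (hA : A ∈ Matrix.unitaryGroup ι ℂ) {α β : ℤ → ℝ} (hα : IsPhaseLift A α)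
    (hβ : IsPhaseLift A β) (hsum : ∑ j ∈ Finset.range (Fintype.card ι), α j =
      ∑ j ∈ Finset.range (Fintype.card ι), β j) : α = β := by
  obtain ⟨k, hk⟩ := hα.exists_eq_shift hA hβ
  have h := sum_range_int_shift_of_quasiperiodic hβ.period k
  rw [← Finset.sum_congr rfl (fun (j : ℕ) _ => hk j), hsum] at h
  have : (k : ℝ) = 0 := by
    have := Real.pi_pos
    have h' : (k : ℝ) * (2 * Real.pi) = 0 := by linarith
    exact (mul_eq_zero.1 h').resolve_right (by positivity)
  have : k = 0 := by exact_mod_cast this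
  funext l
  simpa [this] using hk l

end Lift

/-! ### The lift built from the eigenphases in `(0, 2π]`, and lifts with a prescribed logarithm of
the determinant. -/

section PrincipalLift

variable {ι : Type} [Fintype ι] [DecidableEq ι]

theorem norm_eq_one_of_mem_roots_charpoly {A : Matrix ι ι ℂ} (hA : A ∈ Matrix.unitaryGroup ι ℂ)
    {z : ℂ} (hz : z ∈ A.charpoly.roots) : ‖z‖ = 1 := by
  have h0 : (Matrix.scalar ι z - A).det = 0 := by
    rw [← Matrix.eval_charpoly]
    exact (Polynomial.mem_roots'.1 hz).2
  obtain ⟨v, hv0, hv⟩ := Matrix.exists_mulVec_eq_zero_iff.2 h0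
  have hv0' : (WithLp.toLp 2 v : EuclideanSpace ℂ ι) ≠ 0 := by
    intro h
    exact hv0 (by simpa using h)
  have hAv : Matrix.toEuclideanLin A (WithLp.toLp 2 v) = z • (WithLp.toLp 2 v) := by
    rw [Matrix.toEuclideanLin, Matrix.toLpLin_toLp, ← WithLp.toLp_smul]
    congr 1
    rw [Matrix.sub_mulVec, sub_eq_zero] at hv
    rw [Matrix.toLin'_apply, ← hv]
    ext i
    simp [Matrix.scalar_apply, Matrix.mulVec_diagonal]
  have h := norm_toEuclideanLin_of_mem_unitaryGroup hA (WithLp.toLp 2 v)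
  rw [hAv, norm_smul] at h
  exact mul_right_cancel₀ (norm_ne_zero_iff.2 hv0') (by rw [h, one_mul])

theorem length_eigenphases (A : Matrix ι ι ℂ) : (eigenphases A).length = Fintype.card ι := by
  rw [eigenphases, Multiset.length_sort, Multiset.card_map, ← Matrix.charpoly_natDegree_eq_dim A]
  exact (IsAlgClosed.splits A.charpoly).natDegree_eq_card_roots.symm

theorem mem_eigenphases {A : Matrix ι ι ℂ} {x : ℝ} (hx : x ∈ eigenphases A) :
    x ∈ Set.Ioc 0 (2 * Real.pi) := by
  rw [eigenphases, Multiset.mem_sort, Multiset.mem_map] at hx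
  obtain ⟨z, -, rfl⟩ := hx
  simpa using toIocMod_mem_Ioc Real.two_pi_pos 0 z.arg

theorem getD_eigenphases_mem {A : Matrix ι ι ℂ} {j : ℕ} (hj : j < Fintype.card ι) :
    (eigenphases A).getD j 0 ∈ Set.Ioc 0 (2 * Real.pi) := by
  rw [List.getD_eq_getElem _ _ (by rwa [length_eigenphases])]
  exact mem_eigenphases (List.getElem_mem _)

theorem getD_eigenphases_anti {A : Matrix ι ι ℂ} {i j : ℕ} (hij : i ≤ j)
    (hj : j < Fintype.card ι) : (eigenphases A).getD j 0 ≤ (eigenphases A).getD i 0 := by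
  rw [List.getD_eq_getElem _ _ (by rwa [length_eigenphases]),
    List.getD_eq_getElem _ _ (by rw [length_eigenphases]; omega)]
  rcases hij.eq_or_lt with rfl | h
  · rfl
  · exact List.pairwise_iff_getElem.1 (Multiset.pairwise_sort _ (· ≥ ·)) i j _ _ h

theorem exp_I_mul_toIocMod_arg {z : ℂ} (hz : ‖z‖ = 1) :
    Complex.exp (Complex.I * ((toIocMod Real.two_pi_pos 0 z.arg : ℝ) : ℂ)) = z := by
  rw [toIocMod, zsmul_eq_mul]
  push_cast
  rw [mul_sub, Complex.exp_sub, mul_comm Complex.I (z.arg : ℂ),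
    show Complex.I * ((toIocDiv Real.two_pi_pos 0 z.arg : ℂ) * (2 * Real.pi)) =
      (toIocDiv Real.two_pi_pos 0 z.arg : ℤ) * (2 * Real.pi * Complex.I) by ring,
    Complex.exp_int_mul_two_pi_mul_I, div_one]
  have := Complex.norm_mul_exp_arg_mul_I z
  rwa [hz, Complex.ofReal_one, one_mul] at this

theorem roots_charpoly_eq_sum_eigenphases {A : Matrix ι ι ℂ} (hA : A ∈ Matrix.unitaryGroup ι ℂ) :
    A.charpoly.roots = ∑ j ∈ Finset.range (Fintype.card ι),
      {Complex.exp (Complex.I * ((eigenphases A).getD j 0 : ℂ))} := by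
  have h1 : ((eigenphases A : List ℝ) : Multiset ℝ) =
      A.charpoly.roots.map (fun z => toIocMod Real.two_pi_pos 0 z.arg) := Multiset.sort_eq _ _
  have h2 : A.charpoly.roots =
      ((eigenphases A : List ℝ) : Multiset ℝ).map (fun x : ℝ => Complex.exp (Complex.I * (x : ℂ))) := by
    rw [h1, Multiset.map_map]
    conv_lhs => rw [← Multiset.map_id A.charpoly.roots]
    exact Multiset.map_congr rfl fun z hz =>
      (exp_I_mul_toIocMod_arg (norm_eq_one_of_mem_roots_charpoly hA hz)).symm
  have h3 : eigenphases A = (List.range (Fintype.card ι)).map (fun j => (eigenphases A).getD j 0) := by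
    apply List.ext_getElem
    · simp [length_eigenphases]
    · intro n hn _
      rw [List.getElem_map, List.getElem_range, List.getD_eq_getElem _ _ hn]
  rw [h2]
  conv_lhs => rw [h3]
  rw [Multiset.map_coe, List.map_map]
  exact (Multiset.bind_singleton (Multiset.range (Fintype.card ι)) _).symm

/-- The eigenphases in `(0, 2π]`, extended to a nondecreasing family indexed by `ℤ`. -/
def principalLift (A : Matrix ι ι ℂ) (j : ℤ) : ℝ :=
  -- The list is nonincreasing, hence the reversed index; the quotient of `j` counts full turns. The
  -- default `0` is never reached when `ι` is nonempty.
  (eigenphases A).getD (Fintype.card ι - 1 - (j % Fintype.card ι).toNat) 0 +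
    2 * Real.pi * (j / Fintype.card ι : ℤ)

theorem principalLift_apply (A : Matrix ι ι ℂ) (q : ℤ) {r : ℕ} (hr : r < Fintype.card ι) :
    principalLift A (q * Fintype.card ι + r) =
      (eigenphases A).getD (Fintype.card ι - 1 - r) 0 + 2 * Real.pi * q := by
  have hm : (0 : ℤ) < Fintype.card ι := by omega
  have h1 : (q * Fintype.card ι + r : ℤ) % Fintype.card ι = r := by
    rw [add_comm, Int.add_mul_emod_self_right]
    exact Int.emod_eq_of_lt (by omega) (by omega)
  have h2 : (q * Fintype.card ι + r : ℤ) / Fintype.card ι = q := by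
    rw [add_comm, Int.add_mul_ediv_right _ _ hm.ne', Int.ediv_eq_zero_of_lt (by omega) (by omega),
      zero_add]
  rw [principalLift, h1, h2, Int.toNat_natCast]

theorem exists_eq_mul_add {ι : Type} [Fintype ι] [Nonempty ι] (j : ℤ) :
    ∃ (q : ℤ) (r : ℕ), r < Fintype.card ι ∧ j = q * Fintype.card ι + r := by
  have hm : (0 : ℤ) < Fintype.card ι := by exact_mod_cast Fintype.card_pos
  have h1 := Int.emod_nonneg j hm.ne'
  have h2 := Int.emod_lt_of_pos j hm
  have h3 := Int.emod_add_mul_ediv j (Fintype.card ι)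
  refine ⟨j / Fintype.card ι, (j % Fintype.card ι).toNat, by omega, ?_⟩
  rw [Int.toNat_of_nonneg h1]
  linarith

theorem isPhaseLift_principalLift [Nonempty ι] {A : Matrix ι ι ℂ}
    (hA : A ∈ Matrix.unitaryGroup ι ℂ) : IsPhaseLift A (principalLift A) := by
  refine ⟨monotone_int_of_le_succ fun j => ?_, fun j => ?_, ?_⟩
  · obtain ⟨q, r, hr, rfl⟩ := exists_eq_mul_add (ι := ι) j
    rw [principalLift_apply A q hr]
    by_cases h : r + 1 < Fintype.card ι
    · rw [show q * (Fintype.card ι : ℤ) + r + 1 = q * Fintype.card ι + (r + 1 : ℕ) by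
        push_cast; ring, principalLift_apply A q h]
      have := getD_eigenphases_anti (A := A) (i := Fintype.card ι - 1 - (r + 1))
        (j := Fintype.card ι - 1 - r) (by omega) (by omega)
      linarith
    · have hq := principalLift_apply A (q + 1) (r := 0) (by omega)
      rw [show q * (Fintype.card ι : ℤ) + r + 1 = (q + 1) * Fintype.card ι + (0 : ℕ) by
        rw [show (r : ℤ) = Fintype.card ι - 1 by omega]; push_cast; ring, hq]
      have h1 := (getD_eigenphases_mem (A := A) (j := Fintype.card ι - 1 - r) (by omega)).2
      have h2 := (getD_eigenphases_mem (A := A) (j := Fintype.card ι - 1 - 0) (by omega)).1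
      push_cast
      linarith
  · obtain ⟨q, r, hr, rfl⟩ := exists_eq_mul_add (ι := ι) j
    rw [show q * (Fintype.card ι : ℤ) + r + Fintype.card ι = (q + 1) * Fintype.card ι + r by ring,
      principalLift_apply A q hr, principalLift_apply A (q + 1) hr]
    push_cast
    ring
  · rw [roots_charpoly_eq_sum_eigenphases hA, ← Finset.sum_range_reflect]
    refine Finset.sum_congr rfl fun j hj => ?_
    have := principalLift_apply A 0 (Finset.mem_range.1 hj)
    simp only [zero_mul, zero_add, Int.cast_zero, mul_zero, add_zero] at this
    rw [this]

/-- On the lift the spacing across `2π` is an ordinary difference: the value at index `-1` is the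
largest eigenphase minus `2π`. -/
theorem phaseSpacing_eq_principalLift_sub (A : Matrix ι ι ℂ) {j : ℕ} (hj : j < Fintype.card ι) :
    phaseSpacing A j = principalLift A (Fintype.card ι - 1 - j : ℤ) -
      principalLift A (Fintype.card ι - 1 - j - 1 : ℤ) := by
  have h1 := principalLift_apply A 0 (r := Fintype.card ι - 1 - j) (by omega)
  rw [show (0 : ℤ) * (Fintype.card ι : ℤ) + (Fintype.card ι - 1 - j : ℕ) =
    (Fintype.card ι - 1 - j : ℤ) by omega, Nat.sub_sub_self (by omega)] at h1
  rw [phaseSpacing, h1]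
  split_ifs with h
  · have h2 := principalLift_apply A 0 (r := Fintype.card ι - 1 - (j + 1)) (by omega)
    rw [show (0 : ℤ) * (Fintype.card ι : ℤ) + (Fintype.card ι - 1 - (j + 1) : ℕ) =
      (Fintype.card ι - 1 - j - 1 : ℤ) by omega, Nat.sub_sub_self (by omega)] at h2
    rw [h2]
    push_cast
    ring
  · have h2 := principalLift_apply A (-1) (r := Fintype.card ι - 1) (by omega)
    rw [show (-1 : ℤ) * (Fintype.card ι : ℤ) + (Fintype.card ι - 1 : ℕ) =
      (Fintype.card ι - 1 - j - 1 : ℤ) by omega, Nat.sub_self] at h2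
    rw [h2]
    push_cast
    ring

/-- The sum of a function over the cyclic eigenphase spacings, in terms of any phase lift. -/
theorem IsPhaseLift.sum_phaseSpacing [Nonempty ι] {A : Matrix ι ι ℂ}
    (hA : A ∈ Matrix.unitaryGroup ι ℂ) {θ : ℤ → ℝ} (hθ : IsPhaseLift A θ) (h : ℝ → ℝ) :
    ∑ j ∈ Finset.range (Fintype.card ι), h (phaseSpacing A j) =
      ∑ j ∈ Finset.range (Fintype.card ι), h (θ (j + 1) - θ j) := by
  obtain ⟨k, hk⟩ := (isPhaseLift_principalLift hA).exists_eq_shift hA hθ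
  have h1 : ∀ j ∈ Finset.range (Fintype.card ι), h (phaseSpacing A j) =
      (fun l : ℤ => h (θ (l + 1) - θ l)) ((Fintype.card ι - 1 - j : ℕ) + (k - 1)) := by
    intro j hj
    have hj' := Finset.mem_range.1 hj
    rw [phaseSpacing_eq_principalLift_sub A hj', hk, hk]
    simp only
    congr 3 <;> omega
  rw [Finset.sum_congr rfl h1, Finset.sum_range_reflect
    (fun j : ℕ => (fun l : ℤ => h (θ (l + 1) - θ l)) ((j : ℤ) + (k - 1)))]
  refine sum_range_int_shift_of_periodic (f := fun l : ℤ => h (θ (l + 1) - θ l)) (fun j => ?_) _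
  rw [show j + (Fintype.card ι : ℤ) + 1 = j + 1 + Fintype.card ι by ring, hθ.period, hθ.period]
  congr 1
  ring

theorem IsPhaseLift.det_eq {A : Matrix ι ι ℂ} {θ : ℤ → ℝ} (hθ : IsPhaseLift A θ) :
    A.det = Complex.exp (Complex.I * ((∑ j ∈ Finset.range (Fintype.card ι), θ j : ℝ) : ℂ)) := by
  rw [Matrix.det_eq_prod_roots_charpoly, hθ.roots, Multiset.prod_sum]
  simp only [Multiset.prod_singleton]
  rw [← Complex.exp_sum, ← Finset.mul_sum]
  push_cast
  rfl

/-- A unitary matrix has a phase lift whose first terms add up to a given logarithm of the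
determinant. -/
theorem exists_isPhaseLift [Nonempty ι] {A : Matrix ι ι ℂ} (hA : A ∈ Matrix.unitaryGroup ι ℂ)
    {D : ℝ} (hD : A.det = Complex.exp (Complex.I * (D : ℂ))) :
    ∃ θ, IsPhaseLift A θ ∧ ∑ j ∈ Finset.range (Fintype.card ι), θ j = D := by
  have h := isPhaseLift_principalLift hA
  rw [h.det_eq, Complex.exp_eq_exp_iff_exists_int] at hD
  obtain ⟨k, hk⟩ := hD
  refine ⟨_, h.shift (-k), ?_⟩
  rw [sum_range_int_shift_of_quasiperiodic h.period]
  have h2 : Complex.I * ((∑ j ∈ Finset.range (Fintype.card ι), principalLift A j : ℝ) : ℂ) =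
      Complex.I * ((D + k * (2 * Real.pi) : ℝ) : ℂ) := by
    rw [hk]; push_cast; ring
  have h3 := mul_left_cancel₀ Complex.I_ne_zero h2
  have h4 : ∑ j ∈ Finset.range (Fintype.card ι), principalLift A j = D + k * (2 * Real.pi) := by
    exact_mod_cast h3
  rw [h4]
  push_cast
  ring

end PrincipalLift

/-! ### The continuous family of eigenphases over `ℝ^B`. -/

section Family

variable {B : ℕ}

/-- Cutting the segment into steps shorter than `δ` loses nothing, because the Lipschitz constant is
the same at every step. The eigenphase comparison is available only for small perturbations. -/
theorem abs_sub_le_norm_sub_of_locally {V : Type*} [NormedAddCommGroup V] [NormedSpace ℝ V]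
    {f : V → ℝ} {δ : ℝ} (hδ : 0 < δ) (hf : ∀ x y, ‖x - y‖ < δ → |f x - f y| ≤ ‖x - y‖) (x y : V) :
    |f x - f y| ≤ ‖x - y‖ := by
  obtain ⟨n, hn⟩ := exists_nat_gt (‖x - y‖ / δ)
  have hn0 : (0 : ℝ) < n := lt_of_le_of_lt (by positivity) hn
  rw [div_lt_iff₀ hδ] at hn
  set p : ℕ → V := fun k => y + ((k : ℝ) / n) • (x - y) with hp
  have hstep : ∀ k, p (k + 1) - p k = (1 / (n : ℝ)) • (x - y) := by
    intro k
    rw [hp]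
    simp only
    rw [add_sub_add_left_eq_sub, ← sub_smul]
    congr 1
    push_cast
    ring
  have hnorm : ∀ k, ‖p (k + 1) - p k‖ = ‖x - y‖ / n := by
    intro k
    rw [hstep, norm_smul, Real.norm_of_nonneg (by positivity)]
    ring
  have h0 : p 0 = y := by simp [hp]
  have h1 : p n = x := by
    rw [hp]
    simp only
    rw [div_self hn0.ne', one_smul]
    abel
  have htel := Finset.sum_range_sub (fun k => f (p k)) n
  rw [h0, h1] at htel
  rw [← htel]
  refine (Finset.abs_sum_le_sum_abs _ _).trans ?_
  have hle : ∀ k ∈ Finset.range n, |f (p (k + 1)) - f (p k)| ≤ ‖x - y‖ / n := by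
    intro k _
    have hlt : ‖x - y‖ / n < δ := by
      rw [div_lt_iff₀ hn0]
      linarith
    have := hf (p (k + 1)) (p k) (by rw [hnorm]; exact hlt)
    rwa [hnorm] at this
  refine (Finset.sum_le_sum hle).trans ?_
  rw [Finset.sum_const, Finset.card_range, nsmul_eq_mul, mul_div_cancel₀ _ hn0.ne']

theorem roots_charpoly_smul {ι : Type*} [Fintype ι] [DecidableEq ι] (A : Matrix ι ι ℂ) {c : ℂ}
    (hc : c ≠ 0) : (c • A).charpoly.roots = A.charpoly.roots.map (c * ·) := by
  rw [← Polynomial.roots_scaleRoots _ hc.isUnit]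
  congr 1
  refine Polynomial.funext fun t => ?_
  obtain ⟨s, rfl⟩ : ∃ s, t = c * s := ⟨c⁻¹ * t, by rw [mul_inv_cancel_left₀ hc]⟩
  have h := Polynomial.scaleRoots_eval₂_mul (p := A.charpoly) (RingHom.id ℂ) s c
  simp only [RingHom.id_apply, Polynomial.eval₂_id] at h
  rw [h, Matrix.eval_charpoly, Matrix.eval_charpoly, Matrix.charpoly_natDegree_eq_dim,
    ← Matrix.det_smul, smul_sub]
  congr 2
  ext i j
  simp [Matrix.scalar_apply, Matrix.diagonal_apply]

theorem expDiag_add (x y : Fin B → ℝ) : expDiag (x + y) = expDiag x * expDiag y := by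
  rw [expDiag, expDiag, expDiag, Matrix.diagonal_mul_diagonal]
  congr 1
  funext i
  cases i <;> simp [← Complex.exp_add, mul_add]

theorem expDiag_const (c : ℝ) : expDiag (fun _ : Fin B => c) =
    Complex.exp (Complex.I * (c : ℂ)) • (1 : Matrix (Fin B ⊕ Fin B) (Fin B ⊕ Fin B) ℂ) := by
  rw [expDiag, ← Matrix.diagonal_one, ← Matrix.diagonal_smul]
  congr 1
  funext i
  cases i <;> simp

theorem expDiag_single_two_pi (b : Fin B) : expDiag (Pi.single b (2 * Real.pi)) = 1 := by
  rw [expDiag, ← Matrix.diagonal_one]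
  congr 1
  have h : ∀ b', Complex.exp (Complex.I * ((Pi.single b (2 * Real.pi) : Fin B → ℝ) b' : ℂ)) = 1 := by
    intro b'
    by_cases hb : b' = b
    · subst hb
      rw [Pi.single_eq_same]
      simpa using exp_I_mul_add_two_pi 0
    · rw [Pi.single_eq_of_ne hb]; simp
  funext i
  cases i <;> simp [h]

theorem expDiag_mem_unitaryGroup (x : Fin B → ℝ) :
    expDiag x ∈ Matrix.unitaryGroup (Fin B ⊕ Fin B) ℂ := by
  rw [Matrix.mem_unitaryGroup_iff', Matrix.star_eq_conjTranspose, expDiag,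
    Matrix.diagonal_conjTranspose, Matrix.diagonal_mul_diagonal, ← Matrix.diagonal_one]
  congr 1
  have h : ∀ c : ℝ, (starRingEnd ℂ) (Complex.exp (Complex.I * (c : ℂ))) *
      Complex.exp (Complex.I * (c : ℂ)) = 1 := by
    intro c
    rw [Complex.conj_mul', mul_comm, Complex.norm_exp_ofReal_mul_I]
    simp
  funext i
  cases i <;> simp [h]

theorem det_expDiag (x : Fin B → ℝ) :
    (expDiag x).det = Complex.exp (Complex.I * ((2 * ∑ b, x b : ℝ) : ℂ)) := by
  rw [expDiag, Matrix.det_diagonal, Fintype.prod_sum_type]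
  simp only [Sum.elim_inl, Sum.elim_inr]
  rw [← Complex.exp_sum, ← Complex.exp_add, ← Finset.mul_sum]
  congr 1
  push_cast
  ring

/-- Each coordinate is rotated by at most the sup norm of `d`, which therefore bounds the angle by
which any vector turns. -/
theorem cos_mul_norm_sq_le_re_inner_expDiag {d : Fin B → ℝ} {ε : ℝ} (hε : ε ≤ Real.pi)
    (hd : ‖d‖ ≤ ε) (w : EuclideanSpace ℂ (Fin B ⊕ Fin B)) :
    Real.cos ε * ‖w‖ ^ 2 ≤ (inner ℂ w (Matrix.toEuclideanLin (expDiag d) w)).re := by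
  have hcos : ∀ b, Real.cos ε ≤ Real.cos (d b) := by
    intro b
    rw [← Real.cos_abs (d b)]
    exact Real.cos_le_cos_of_nonneg_of_le_pi (abs_nonneg _) hε ((norm_le_pi_norm d b).trans hd)
  rw [EuclideanSpace.norm_sq_eq, PiLp.inner_apply, Complex.re_sum, Finset.mul_sum]
  have hterm : ∀ (z : ℂ) (c : ℝ), Real.cos ε ≤ Real.cos c → Real.cos ε * ‖z‖ ^ 2 ≤
      (inner ℂ z (Complex.exp (Complex.I * (c : ℂ)) * z)).re := by
    intro z c hc
    rw [RCLike.inner_apply, mul_assoc, Complex.mul_conj', mul_comm Complex.I,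
      mul_comm (Complex.exp _), ← Complex.ofReal_pow, Complex.re_ofReal_mul,
      Complex.exp_ofReal_mul_I_re, mul_comm]
    exact mul_le_mul_of_nonneg_left hc (by positivity)
  refine Finset.sum_le_sum fun i _ => ?_
  have hi : (Matrix.toEuclideanLin (expDiag d) w) i = Sum.elim
      (fun b => Complex.exp (Complex.I * (d b : ℂ)))
      (fun b => Complex.exp (Complex.I * (d b : ℂ))) i * w i := by
    rw [Matrix.toEuclideanLin, Matrix.toLpLin_apply, expDiag, PiLp.toLp_apply]
    exact Matrix.mulVec_diagonal _ _ _
  rw [hi]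
  cases i with
  | inl b => exact hterm _ _ (hcos b)
  | inr b => exact hterm _ _ (hcos b)

/-- A continuous choice of all eigenphases of `e^{ix} S₀`, for `x ∈ ℝ^B`: `θ x j` is nondecreasing in
`j ∈ ℤ`. -/
structure IsPhaseFamily (θ : (Fin B → ℝ) → ℤ → ℝ) : Prop where
  mono : ∀ x, Monotone (θ x)
  period : ∀ x j, θ x (j + (2 * B : ℕ)) = θ x j + 2 * Real.pi
  lipschitz : ∀ x y j, |θ x j - θ y j| ≤ ‖x - y‖
  add_const : ∀ x (c : ℝ) j, θ (x + fun _ => c) j = θ x j + c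
  -- The matrix is unchanged while the phases of one period gain `4π` in total, as `x b` occupies
  -- two diagonal entries; so the numbering moves by two.
  add_single : ∀ x b j, θ (x + Pi.single b (2 * Real.pi)) j = θ x (j + 2)
  sum_eq : ∃ D₀ : ℝ, ∀ x, ∑ j ∈ Finset.range (2 * B), θ x j = D₀ + 2 * ∑ b, x b

/-- At each `x` the lift is selected by requiring its first `2B` terms to sum to `D₀ + 2 ∑ x b`, a
global logarithm of the determinant. As this sum varies continuously, the perturbation bound applies
without renumbering. Both translation rules follow from uniqueness: the two sides lift the same
matrix with the same sum. -/
theorem exists_isPhaseFamily (hB : 1 ≤ B) {S₀ : Matrix (Fin B ⊕ Fin B) (Fin B ⊕ Fin B) ℂ}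
    (hS₀ : S₀ ∈ Matrix.unitaryGroup (Fin B ⊕ Fin B) ℂ) :
    ∃ θ : (Fin B → ℝ) → ℤ → ℝ, (∀ x, IsPhaseLift (expDiag x * S₀) (θ x)) ∧ IsPhaseFamily θ := by
  have : Nonempty (Fin B ⊕ Fin B) := ⟨Sum.inl ⟨0, hB⟩⟩
  have hcard : Fintype.card (Fin B ⊕ Fin B) = 2 * B := by
    rw [Fintype.card_sum, Fintype.card_fin]; ring
  have hU : ∀ x, expDiag x * S₀ ∈ Matrix.unitaryGroup (Fin B ⊕ Fin B) ℂ := fun x =>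
    mul_mem (expDiag_mem_unitaryGroup x) hS₀
  set D₀ : ℝ := S₀.det.arg with hD₀
  have hdet : ∀ x : Fin B → ℝ, (expDiag x * S₀).det =
      Complex.exp (Complex.I * ((D₀ + 2 * ∑ b, x b : ℝ) : ℂ)) := by
    intro x
    have hnorm : ‖S₀.det‖ = 1 :=
      CStarRing.norm_of_mem_unitary (Matrix.det_of_mem_unitary hS₀)
    have h := Complex.norm_mul_exp_arg_mul_I S₀.det
    rw [hnorm, Complex.ofReal_one, one_mul] at h
    rw [Matrix.det_mul, det_expDiag, ← h, ← Complex.exp_add]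
    congr 1
    push_cast
    ring
  choose θ hθ hsum using fun x => exists_isPhaseLift (hU x) (hdet x)
  -- The radius is the one for which `4 ‖x - y‖ < 2π / (2B)`, as `IsPhaseLift.abs_sub_le` demands.
  have hloc : ∀ j x y, ‖x - y‖ < Real.pi / (2 * (2 * B : ℕ)) → |θ x j - θ y j| ≤ ‖x - y‖ := by
    intro j x y hxy
    have hB' : (0 : ℝ) < (2 * B : ℕ) := by exact_mod_cast (by omega)
    have hB1 : (1 : ℝ) ≤ (2 * B : ℕ) := by exact_mod_cast (by omega)
    refine (hθ x).abs_sub_le (hU x) (hU y) (hθ y) (norm_nonneg _) ?_ (fun v => ?_) ?_ j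
    · rw [hcard, lt_div_iff₀ hB']
      rw [lt_div_iff₀ (by positivity)] at hxy
      linarith
    · have hpi : ‖x - y‖ ≤ Real.pi := hxy.le.trans (by
        rw [div_le_iff₀ (by positivity)]
        nlinarith [Real.pi_pos])
      have h1 := cos_mul_norm_sq_le_re_inner_expDiag hpi (norm_sub_rev y x).le
        (Matrix.toEuclideanLin (expDiag x * S₀) v)
      rw [norm_toEuclideanLin_of_mem_unitaryGroup (hU x), ← LinearMap.comp_apply,
        Matrix.toEuclideanLin, ← Matrix.toLpLin_mul_same, ← Matrix.mul_assoc, ← expDiag_add,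
        sub_add_cancel] at h1
      exact h1
    · rw [hsum, hsum, hcard, add_sub_add_left_eq_sub, ← mul_sub, ← Finset.sum_sub_distrib, abs_mul,
        abs_two]
      have : |∑ b, (x b - y b)| ≤ ∑ _b : Fin B, ‖x - y‖ :=
        (Finset.abs_sum_le_sum_abs _ _).trans (Finset.sum_le_sum fun b _ =>
          norm_le_pi_norm (x - y) b)
      rw [Finset.sum_const, Finset.card_univ, Fintype.card_fin, nsmul_eq_mul] at this
      push_cast
      linarith
  refine ⟨θ, hθ, fun x => (hθ x).mono, fun x j => hcard ▸ (hθ x).period j, fun x y j => ?_,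
    fun x c j => ?_, fun x b j => ?_, D₀, fun x => hcard ▸ hsum x⟩
  · have hB' : (0 : ℝ) < (2 * B : ℕ) := by exact_mod_cast (by omega)
    exact abs_sub_le_norm_sub_of_locally (f := fun x => θ x j)
      (by have := Real.pi_pos; positivity) (hloc j) x y
  · have hlift : IsPhaseLift (expDiag (x + fun _ => c) * S₀) (fun j => θ x j + c) := by
      refine ⟨fun i j hij => by simpa using (hθ x).mono hij, fun j => ?_, ?_⟩
      · rw [(hθ x).period]; ring
      · rw [add_comm x, expDiag_add, expDiag_const, smul_mul_assoc, one_mul, smul_mul_assoc,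
          roots_charpoly_smul _ (Complex.exp_ne_zero _), (hθ x).roots, ← Multiset.coe_mapAddMonoidHom,
          map_sum]
        refine Finset.sum_congr rfl fun j _ => ?_
        rw [Multiset.coe_mapAddMonoidHom, Multiset.map_singleton, ← Complex.exp_add]
        push_cast
        congr 2
        ring
    refine congrFun ((hθ _).eq_of_sum_eq (hU _) hlift ?_) j
    rw [hsum, Finset.sum_add_distrib, hsum, hcard]
    simp only [Pi.add_apply, Finset.sum_add_distrib, Finset.sum_const, Finset.card_range,
      Finset.card_univ, Fintype.card_fin, nsmul_eq_mul]
    push_cast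
    ring
  · have hlift : IsPhaseLift (expDiag (x + Pi.single b (2 * Real.pi)) * S₀)
        (fun j => θ x (j + 2)) := by
      rw [expDiag_add, expDiag_single_two_pi, mul_one]
      exact (hθ x).shift 2
    refine congrFun ((hθ _).eq_of_sum_eq (hU _) hlift ?_) j
    rw [hsum, sum_range_int_shift_of_quasiperiodic (hθ x).period, hsum]
    simp only [Pi.add_apply, Finset.sum_add_distrib, Finset.sum_pi_single', Finset.mem_univ,
      if_true]
    push_cast
    ring

end Family

/-! ### Times at which eigenphases vanish along the linear flow. -/

section Crossing

variable {B : ℕ} {θ : (Fin B → ℝ) → ℤ → ℝ}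

/-- Split `L` into the constant `(a + c) / 2`, which moves phases exactly, and a remainder of sup
norm at most `(c - a) / 2`, which is handled by the Lipschitz bound. -/
theorem IsPhaseFamily.slope_bounds (hθ : IsPhaseFamily θ) {L : Fin B → ℝ} {a c : ℝ}
    (hac : a ≤ c) (ha : ∀ b, a ≤ L b) (hc : ∀ b, L b ≤ c) (x : Fin B → ℝ) (j : ℤ) {s t : ℝ}
    (hst : s ≤ t) :
    a * (t - s) ≤ θ (x + t • L) j - θ (x + s • L) j ∧
      θ (x + t • L) j - θ (x + s • L) j ≤ c * (t - s) := by
  set y : Fin B → ℝ := x + s • L + (t - s) • (L - fun _ => (a + c) / 2) with hy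
  have h1 : x + t • L = y + fun _ => (t - s) * ((a + c) / 2) := by
    funext b
    simp only [hy, Pi.add_apply, Pi.smul_apply, Pi.sub_apply, smul_eq_mul]
    ring
  have h2 := hθ.lipschitz y (x + s • L) j
  have h3 : ‖y - (x + s • L)‖ ≤ (t - s) * ((c - a) / 2) := by
    rw [hy, add_sub_cancel_left, norm_smul, Real.norm_of_nonneg (sub_nonneg.2 hst)]
    refine mul_le_mul_of_nonneg_left ?_ (sub_nonneg.2 hst)
    refine (pi_norm_le_iff_of_nonneg (by linarith)).2 fun b => ?_
    rw [Pi.sub_apply, Real.norm_eq_abs, abs_le]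
    constructor <;> linarith [ha b, hc b]
  rw [h1, hθ.add_const]
  have h4 := abs_le.1 (h2.trans h3)
  constructor <;> linarith [h4.1, h4.2]

theorem exists_bounds (hB : 1 ≤ B) {L : Fin B → ℝ} (hL : ∀ b, 0 < L b) :
    ∃ a c : ℝ, 0 < a ∧ a ≤ c ∧ (∀ b, a ≤ L b) ∧ ∀ b, L b ≤ c := by
  have : Nonempty (Fin B) := ⟨⟨0, hB⟩⟩
  obtain ⟨b₀, hb₀⟩ := Finite.exists_min L
  obtain ⟨b₁, hb₁⟩ := Finite.exists_max L
  exact ⟨L b₀, L b₁, hL b₀, hb₀ b₁, hb₀, hb₁⟩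

theorem IsPhaseFamily.continuous (hθ : IsPhaseFamily θ) (j : ℤ) : Continuous fun x => θ x j := by
  refine (LipschitzWith.of_dist_le_mul (K := 1) fun x y => ?_).continuous
  rw [Real.dist_eq, dist_eq_norm, NNReal.coe_one, one_mul]
  exact hθ.lipschitz x y j

theorem IsPhaseFamily.strictMono (hθ : IsPhaseFamily θ) (hB : 1 ≤ B) {L : Fin B → ℝ}
    (hL : ∀ b, 0 < L b) (x : Fin B → ℝ) (j : ℤ) : StrictMono fun t : ℝ => θ (x + t • L) j := by
  obtain ⟨a, c, ha, hac, haL, hcL⟩ := exists_bounds hB hL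
  intro s t hst
  have := (hθ.slope_bounds hac haL hcL x j hst.le).1
  have h2 : 0 < a * (t - s) := mul_pos ha (sub_pos.2 hst)
  simp only
  linarith

theorem IsPhaseFamily.exists_crossing (hθ : IsPhaseFamily θ) (hB : 1 ≤ B) {L : Fin B → ℝ}
    (hL : ∀ b, 0 < L b) (x : Fin B → ℝ) (j : ℤ) : ∃ t : ℝ, θ (x + t • L) j = 0 := by
  obtain ⟨a, c, ha, hac, haL, hcL⟩ := exists_bounds hB hL
  set v := θ x j with hv
  set T := |v| / a with hT
  have hT0 : 0 ≤ T := by positivity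
  have haT : a * T = |v| := by rw [hT]; field_simp
  have h1 := (hθ.slope_bounds hac haL hcL x j hT0).1
  have h2 := (hθ.slope_bounds hac haL hcL x j (neg_nonpos.2 hT0)).1
  simp only [zero_smul, add_zero] at h1 h2
  have hcont : Continuous fun t : ℝ => θ (x + t • L) j :=
    (hθ.continuous j).comp (by fun_prop)
  have := intermediate_value_Icc (by linarith : -T ≤ T) hcont.continuousOn
  obtain ⟨t, -, ht⟩ := this (show (0 : ℝ) ∈ Set.Icc _ _ from
    ⟨by linarith [le_abs_self v], by linarith [neg_abs_le v]⟩)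
  exact ⟨t, ht⟩

/-- The time at which the orbit `t ↦ x + t L` makes the eigenphase with index `-n` vanish. -/
def crossing (θ : (Fin B → ℝ) → ℤ → ℝ) (x L : Fin B → ℝ) (n : ℤ) : ℝ :=
  -- Phases grow with `t`, so lower ones vanish later; the sign in `-n` makes the crossing times
  -- nondecreasing in `n`. For positive `L` such a `t` exists and is unique.
  Classical.epsilon fun t : ℝ => θ (x + t • L) (-n) = 0

theorem IsPhaseFamily.crossing_spec (hθ : IsPhaseFamily θ) (hB : 1 ≤ B) {L : Fin B → ℝ}
    (hL : ∀ b, 0 < L b) (x : Fin B → ℝ) (n : ℤ) : θ (x + crossing θ x L n • L) (-n) = 0 :=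
  Classical.epsilon_spec (hθ.exists_crossing hB hL x (-n))

theorem IsPhaseFamily.crossing_eq_iff (hθ : IsPhaseFamily θ) (hB : 1 ≤ B) {L : Fin B → ℝ}
    (hL : ∀ b, 0 < L b) {x : Fin B → ℝ} {n : ℤ} {t : ℝ} :
    crossing θ x L n = t ↔ θ (x + t • L) (-n) = 0 := by
  constructor
  · rintro rfl
    exact hθ.crossing_spec hB hL x n
  · intro h
    exact (hθ.strictMono hB hL x (-n)).injective
      ((hθ.crossing_spec hB hL x n).trans h.symm)

theorem IsPhaseFamily.crossing_le_iff (hθ : IsPhaseFamily θ) (hB : 1 ≤ B) {L : Fin B → ℝ}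
    (hL : ∀ b, 0 < L b) {x : Fin B → ℝ} {n : ℤ} {t : ℝ} :
    crossing θ x L n ≤ t ↔ 0 ≤ θ (x + t • L) (-n) := by
  rw [← (hθ.strictMono hB hL x (-n)).le_iff_le, hθ.crossing_spec hB hL x n]

theorem IsPhaseFamily.crossing_mono (hθ : IsPhaseFamily θ) (hB : 1 ≤ B) {L : Fin B → ℝ}
    (hL : ∀ b, 0 < L b) (x : Fin B → ℝ) : Monotone (crossing θ x L) := by
  intro i j hij
  rw [hθ.crossing_le_iff hB hL]
  exact (hθ.crossing_spec hB hL x j).ge.trans (hθ.mono _ (by omega))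

/-- Between these two crossings the phase of index `-n` gains exactly `2π`, at a speed between `a`
and `c`. -/
theorem IsPhaseFamily.crossing_add_period (hθ : IsPhaseFamily θ) (hB : 1 ≤ B) {L : Fin B → ℝ}
    {a c : ℝ} (ha : 0 < a) (hac : a ≤ c) (haL : ∀ b, a ≤ L b) (hcL : ∀ b, L b ≤ c)
    (x : Fin B → ℝ) (n : ℤ) :
    crossing θ x L n + 2 * Real.pi / c ≤ crossing θ x L (n + (2 * B : ℕ)) ∧
      crossing θ x L (n + (2 * B : ℕ)) ≤ crossing θ x L n + 2 * Real.pi / a := by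
  have hL : ∀ b, 0 < L b := fun b => ha.trans_le (haL b)
  have h1 := hθ.crossing_spec hB hL x n
  have h2 := hθ.crossing_spec hB hL x (n + (2 * B : ℕ))
  have h3 := hθ.period (x + crossing θ x L (n + (2 * B : ℕ)) • L) (-(n + (2 * B : ℕ)))
  rw [show -(n + ((2 * B : ℕ) : ℤ)) + (2 * B : ℕ) = -n by ring, h2] at h3
  have h4 := hθ.slope_bounds hac haL hcL x (-n)
    (hθ.crossing_mono hB hL x (show n ≤ n + (2 * B : ℕ) by omega))
  rw [h3, h1] at h4
  have hc : 0 < c := ha.trans_le hac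
  constructor
  · rw [← le_sub_iff_add_le', div_le_iff₀ hc]
    linarith [h4.2]
  · rw [← sub_le_iff_le_add', le_div_iff₀ ha]
    linarith [h4.1]

theorem IsPhaseFamily.crossing_add_smul (hθ : IsPhaseFamily θ) (hB : 1 ≤ B) {L : Fin B → ℝ}
    (hL : ∀ b, 0 < L b) (x : Fin B → ℝ) (t : ℝ) (n : ℤ) :
    crossing θ (x + t • L) L n = crossing θ x L n - t := by
  rw [hθ.crossing_eq_iff hB hL, add_assoc, ← add_smul, add_sub_cancel]
  exact hθ.crossing_spec hB hL x n

theorem IsPhaseFamily.crossing_add_single (hθ : IsPhaseFamily θ) (hB : 1 ≤ B) {L : Fin B → ℝ}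
    (hL : ∀ b, 0 < L b) (x : Fin B → ℝ) (b : Fin B) (n : ℤ) :
    crossing θ (x + Pi.single b (2 * Real.pi)) L n = crossing θ x L (n - 2) := by
  rw [hθ.crossing_eq_iff hB hL, add_right_comm, hθ.add_single,
    show -n + 2 = -(n - 2) by ring]
  exact hθ.crossing_spec hB hL x (n - 2)

theorem IsPhaseFamily.crossing_const (hθ : IsPhaseFamily θ) (hB : 1 ≤ B) {l : ℝ} (hl : 0 < l)
    (x : Fin B → ℝ) (n : ℤ) : crossing θ x (fun _ => l) n = -θ x (-n) / l := by
  rw [hθ.crossing_eq_iff hB (fun _ => hl)]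
  have h : x + (-θ x (-n) / l) • (fun _ : Fin B => l) = x + fun _ => -θ x (-n) := by
    funext b
    simp only [Pi.add_apply, Pi.smul_apply, smul_eq_mul]
    rw [div_mul_cancel₀ _ hl.ne']
  rw [h, hθ.add_const, add_neg_cancel]

/-- At the old crossing time the perturbed phase differs from zero by at most the displacement of
the orbit; the speed, at least `a`, makes up for this within the stated time. -/
theorem IsPhaseFamily.abs_crossing_sub_le (hθ : IsPhaseFamily θ) (hB : 1 ≤ B) {L L' : Fin B → ℝ}
    (hL : ∀ b, 0 < L b) {a : ℝ} (ha : 0 < a) (haL : ∀ b, a ≤ L' b) (x x' : Fin B → ℝ) (n : ℤ) :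
    |crossing θ x' L' n - crossing θ x L n| ≤
      (‖x' - x‖ + |crossing θ x L n| * ‖L' - L‖) / a := by
  have hL' : ∀ b, 0 < L' b := fun b => ha.trans_le (haL b)
  obtain ⟨-, c, -, -, -, hcL⟩ := exists_bounds hB hL'
  have hac : a ≤ c := (haL ⟨0, hB⟩).trans (hcL ⟨0, hB⟩)
  set s := crossing θ x L n with hs
  set s' := crossing θ x' L' n with hs'
  have h1 : θ (x + s • L) (-n) = 0 := hθ.crossing_spec hB hL x n
  have h2 : θ (x' + s' • L') (-n) = 0 := hθ.crossing_spec hB hL' x' n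
  have h3 : |θ (x' + s • L') (-n)| ≤ ‖x' - x‖ + |s| * ‖L' - L‖ := by
    have h := hθ.lipschitz (x' + s • L') (x + s • L) (-n)
    rw [h1, sub_zero, add_sub_add_comm, ← smul_sub] at h
    refine h.trans ((norm_add_le _ _).trans ?_)
    rw [norm_smul, Real.norm_eq_abs]
  rw [le_div_iff₀ ha]
  refine le_trans ?_ h3
  rcases le_total s s' with h | h
  · have := (hθ.slope_bounds hac haL hcL x' (-n) h).1
    rw [h2] at this
    rw [abs_of_nonneg (sub_nonneg.2 h)]
    linarith [neg_abs_le (θ (x' + s • L') (-n))]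
  · have := (hθ.slope_bounds hac haL hcL x' (-n) h).1
    rw [h2] at this
    rw [abs_of_nonpos (sub_nonpos.2 h)]
    linarith [le_abs_self (θ (x' + s • L') (-n))]

/-- The vectors with positive entries. -/
abbrev PositiveLengths (B : ℕ) : Type := {L : Fin B → ℝ // ∀ b, 0 < L b}

theorem IsPhaseFamily.continuous_crossing (hθ : IsPhaseFamily θ) (hB : 1 ≤ B) (n : ℤ) :
    Continuous fun p : (Fin B → ℝ) × PositiveLengths B => crossing θ p.1 p.2.1 n := by
  rw [continuous_iff_continuousAt]
  rintro ⟨x, L, hL⟩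
  obtain ⟨a, c, ha, hac, haL, hcL⟩ := exists_bounds hB hL
  have hev : ∀ᶠ p : (Fin B → ℝ) × PositiveLengths B in 𝓝 (x, ⟨L, hL⟩),
      ∀ b, a / 2 ≤ p.2.1 b := by
    rw [eventually_all]
    intro b
    have hc : Continuous fun p : (Fin B → ℝ) × PositiveLengths B => p.2.1 b :=
      (continuous_apply b).comp (continuous_subtype_val.comp continuous_snd)
    refine (hc.tendsto (x, ⟨L, hL⟩)).eventually_const_le ?_
    have := haL b
    simp only
    linarith
  rw [ContinuousAt, tendsto_iff_norm_sub_tendsto_zero]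
  have hlim : Tendsto (fun p : (Fin B → ℝ) × PositiveLengths B =>
      (‖p.1 - x‖ + |crossing θ x L n| * ‖p.2.1 - L‖) / (a / 2)) (𝓝 (x, ⟨L, hL⟩)) (𝓝 0) := by
    have hc : Continuous fun p : (Fin B → ℝ) × PositiveLengths B =>
      (‖p.1 - x‖ + |crossing θ x L n| * ‖p.2.1 - L‖) / (a / 2) := by fun_prop
    have := hc.tendsto (x, ⟨L, hL⟩)
    simpa using this
  refine squeeze_zero' (Eventually.of_forall fun p => norm_nonneg _) ?_ hlim
  filter_upwards [hev] with p hp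
  exact hθ.abs_crossing_sub_le hB hL (half_pos ha) hp x p.1 n

/-- Weyl's law with bounded error. At the crossing, the `2B` consecutive phases from index `-n` on
start at `0`, so their sum lies in `[0, 4πB]`; it also equals `D₀ + 2 ∑ y b - 2πn`. -/
theorem IsPhaseFamily.exists_abs_crossing_sub_le (hθ : IsPhaseFamily θ) (hB : 1 ≤ B)
    {L : Fin B → ℝ} (hL : ∀ b, 0 < L b) (x : Fin B → ℝ) :
    ∃ C : ℝ, ∀ n : ℤ, |crossing θ x L n * ∑ b, L b - Real.pi * n| ≤ C := by
  obtain ⟨D₀, hD₀⟩ := hθ.sum_eq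
  refine ⟨|D₀| / 2 + |∑ b, x b| + 2 * Real.pi * B, fun n => ?_⟩
  set y := x + crossing θ x L n • L with hy
  have h0 : θ y (-n) = 0 := hθ.crossing_spec hB hL x n
  have hsum := sum_range_int_shift_of_quasiperiodic (hθ.period y) (-n)
  rw [hD₀] at hsum
  have hsy : ∑ b, y b = ∑ b, x b + crossing θ x L n * ∑ b, L b := by
    simp [hy, Finset.sum_add_distrib, Finset.mul_sum]
  rw [hsy] at hsum
  have hlow : 0 ≤ ∑ j ∈ Finset.range (2 * B), θ y (j + -n) := by
    refine Finset.sum_nonneg fun j _ => ?_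
    rw [← h0]
    exact hθ.mono y (by omega)
  have hup : ∑ j ∈ Finset.range (2 * B), θ y (j + -n) ≤ ∑ _j ∈ Finset.range (2 * B), 2 * Real.pi := by
    refine Finset.sum_le_sum fun j hj => ?_
    have hj := Finset.mem_range.1 hj
    have := hθ.period y (-n)
    rw [h0, zero_add] at this
    rw [← this]
    exact hθ.mono y (by omega)
  rw [Finset.sum_const, Finset.card_range, nsmul_eq_mul] at hup
  push_cast at hsum hup
  rw [abs_le]
  constructor <;> linarith [le_abs_self D₀, neg_abs_le D₀, le_abs_self (∑ b, x b),
    neg_abs_le (∑ b, x b)]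

end Crossing

/-! ### Order of vanishing of the secular function. -/

section Multiplicity

open Asymptotics

/-- An analytic function of the size of `(t - μ) ^ k` has order `k` at `μ`. -/
theorem analyticOrderAt_eq_of_isTheta {f : ℝ → ℂ} {μ : ℝ} {k : ℕ} (hf : AnalyticAt ℝ f μ)
    (h : f =Θ[𝓝 μ] fun t => (t - μ) ^ k) : analyticOrderAt f μ = k := by
  have hfreq : ∀ n : ℕ, ∃ᶠ t in 𝓝 μ, (t - μ) ^ n ≠ 0 := by
    intro n
    have h1 : ∀ᶠ t in 𝓝[≠] μ, (t - μ) ^ n ≠ 0 := by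
      filter_upwards [self_mem_nhdsWithin] with t ht
      exact pow_ne_zero _ (sub_ne_zero.2 ht)
    exact h1.frequently.filter_mono nhdsWithin_le_nhds
  have hpow : ∀ {n l : ℕ}, (fun t : ℝ => (t - μ) ^ n) =Θ[𝓝 μ] (fun t => (t - μ) ^ l) → n ≤ l := by
    intro n l hnl
    by_contra! hlt
    exact (isLittleO_pow_sub_pow_sub μ hlt).not_isBigO
      ((hfreq n).mono fun t ht => by rw [← norm_pow]; exact norm_ne_zero_iff.2 ht)
      (by simpa only [norm_pow] using hnl.2.norm_norm)
  cases hn : analyticOrderAt f μ with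
  | top =>
    exfalso
    rw [analyticOrderAt_eq_top] at hn
    have h1 : (fun t : ℝ => (t - μ) ^ k) =O[𝓝 μ] (fun _ => (0 : ℂ)) :=
      h.2.trans_eventuallyEq hn
    rw [isBigO_zero_right_iff] at h1
    exact (hfreq k) (h1.mono fun t ht hne => hne ht)
  | coe n =>
    obtain ⟨g, hg, hg0, hfg⟩ := hf.analyticOrderAt_eq_natCast.1 hn
    have hgθ : g =Θ[𝓝 μ] (fun _ => (1 : ℝ)) :=
      ⟨hg.continuousAt.tendsto.isBigO_one ℝ, (isBigO_const_left_iff_pos_le_norm one_ne_zero).2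
        ⟨‖g μ‖ / 2, by positivity, hg.continuousAt.tendsto.norm.eventually_const_le
          (half_lt_self (norm_pos_iff.2 hg0))⟩⟩
    have h2 : f =Θ[𝓝 μ] (fun t => (t - μ) ^ n) := by
      refine EventuallyEq.trans_isTheta (show f =ᶠ[𝓝 μ] fun t => (t - μ) ^ n • g t from hfg) ?_
      have := (isTheta_refl (fun t : ℝ => (t - μ) ^ n) (𝓝 μ)).smul hgθ
      simpa using this
    have h3 : (fun t : ℝ => (t - μ) ^ n) =Θ[𝓝 μ] (fun t => (t - μ) ^ k) := h2.symm.trans h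
    rw [le_antisymm (hpow h3) (hpow h3.symm)]

/-- Use `|1 - e^{iu}| = 2 |sin (u/2)|`. The phases are only known to be bi-Lipschitz along the
orbit, so the order of a zero is read off from sizes and not from derivatives. -/
theorem isTheta_one_sub_exp {u : ℝ → ℝ} {μ a c : ℝ} (ha : 0 < a)
    (hlow : ∀ t, a * |t - μ| ≤ |u t|) (hup : ∀ t, |u t| ≤ c * |t - μ|) :
    (fun t => 1 - Complex.exp (Complex.I * (u t : ℂ))) =Θ[𝓝 μ] fun t => t - μ := by
  have hnorm : ∀ t, ‖1 - Complex.exp (Complex.I * (u t : ℂ))‖ = 2 * |Real.sin (u t / 2)| := by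
    intro t
    rw [norm_sub_rev, Complex.norm_exp_I_mul_ofReal_sub_one, norm_mul, Real.norm_eq_abs,
      Real.norm_eq_abs, abs_two]
  constructor
  · refine IsBigO.of_bound c (Eventually.of_forall fun t => ?_)
    rw [hnorm, Real.norm_eq_abs]
    have h1 : |Real.sin (u t / 2)| ≤ |u t / 2| := Real.abs_sin_le_abs
    rw [abs_div, abs_two] at h1
    linarith [hup t]
  · refine IsBigO.of_bound (Real.pi / (2 * a)) ?_
    have hu : Tendsto (fun t => |u t|) (𝓝 μ) (𝓝 0) := by
      refine squeeze_zero (fun t => abs_nonneg _) hup ?_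
      have hc : Continuous fun t : ℝ => c * |t - μ| := by fun_prop
      simpa using hc.tendsto μ
    filter_upwards [hu.eventually_le_const Real.pi_pos] with t ht
    rw [hnorm, Real.norm_eq_abs]
    have h2 := Real.mul_abs_le_abs_sin (x := u t / 2) (by rw [abs_div, abs_two]; linarith)
    rw [abs_div, abs_two] at h2
    have h3 := hlow t
    have hpi := Real.pi_pos
    have h4 : |u t| ≤ Real.pi * |Real.sin (u t / 2)| := by
      have h5 : 2 / Real.pi * (|u t| / 2) = |u t| / Real.pi := by ring
      rw [h5, div_le_iff₀ hpi] at h2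
      linarith
    rw [show Real.pi / (2 * a) * (2 * |Real.sin (u t / 2)|) =
      Real.pi * |Real.sin (u t / 2)| / a by field_simp, le_div_iff₀ ha]
    linarith

variable {B : ℕ} {S₀ : Matrix (Fin B ⊕ Fin B) (Fin B ⊕ Fin B) ℂ}

theorem analyticAt_secular (S₀ : Matrix (Fin B ⊕ Fin B) (Fin B ⊕ Fin B) ℂ) (L : Fin B → ℝ)
    (μ : ℝ) : AnalyticAt ℝ (secular S₀ L) μ := by
  have hexp : ∀ b, AnalyticAt ℝ (fun t : ℝ => Complex.exp (Complex.I * ((t • L) b : ℂ))) μ := by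
    intro b
    have h1 : AnalyticAt ℝ (fun t : ℝ => Complex.I * ((t • L) b : ℂ)) μ := by
      have h2 : (fun t : ℝ => Complex.I * ((t • L) b : ℂ)) =
          fun t : ℝ => Complex.I * (Complex.ofRealCLM t * (L b : ℂ)) := by
        funext t
        simp
      rw [h2]
      exact analyticAt_const.mul ((Complex.ofRealCLM.analyticAt μ).mul analyticAt_const)
    exact (analyticAt_cexp.restrictScalars (𝕜 := ℝ)).comp h1
  have hsec : secular S₀ L = fun t => ∑ σ : Equiv.Perm (Fin B ⊕ Fin B),
      ((Equiv.Perm.sign σ : ℤ) : ℂ) * ∏ i, (1 - evolution S₀ L t) (σ i) i := by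
    funext t
    rw [secular, Matrix.det_apply']
  rw [hsec]
  refine Finset.analyticAt_fun_sum _ fun σ _ => analyticAt_const.mul
    (Finset.analyticAt_fun_prod _ fun i _ => ?_)
  simp only [evolution, expDiag, Matrix.sub_apply, Matrix.diagonal_mul]
  refine analyticAt_const.sub (AnalyticAt.mul ?_ analyticAt_const)
  cases σ i with
  | inl b => exact hexp b
  | inr b => exact hexp b

theorem IsPhaseLift.det_one_sub {ι : Type} [Fintype ι] [DecidableEq ι] {A : Matrix ι ι ℂ}
    {θ : ℤ → ℝ} (hθ : IsPhaseLift A θ) : (1 - A).det =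
      ∏ j ∈ Finset.range (Fintype.card ι), (1 - Complex.exp (Complex.I * (θ j : ℂ))) := by
  have h := Matrix.eval_charpoly A 1
  rw [map_one] at h
  rw [← h, (IsAlgClosed.splits A.charpoly).eval_eq_prod_roots_of_monic A.charpoly_monic, hθ.roots,
    ← Multiset.coe_mapAddMonoidHom, map_sum, Multiset.prod_sum]
  simp

/-- The multiplicity of a zero of the secular function is the number of eigenphases that vanish
there. -/
theorem analyticOrderAt_secular (hB : 1 ≤ B) {θ : (Fin B → ℝ) → ℤ → ℝ} (hθ : IsPhaseFamily θ)
    (hlift : ∀ x, IsPhaseLift (expDiag x * S₀) (θ x)) {L : Fin B → ℝ} (hL : ∀ b, 0 < L b) (μ : ℝ) :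
    {n : ℤ | crossing θ 0 L n = μ}.encard = analyticOrderAt (secular S₀ L) μ := by
  have hcard : Fintype.card (Fin B ⊕ Fin B) = 2 * B := by
    rw [Fintype.card_sum, Fintype.card_fin]; ring
  obtain ⟨a, c, ha, hac, haL, hcL⟩ := exists_bounds hB hL
  set y : Fin B → ℝ := μ • L with hy
  have hbelow : ∃ z : ℤ, θ y z < 0 := by
    obtain ⟨q, hq⟩ := exists_nat_gt (θ y 0 / (2 * Real.pi))
    refine ⟨(-q : ℤ) * (2 * B : ℕ), ?_⟩
    have h2 := quasiperiodic_mul (hθ.period y) 0 (-q : ℤ)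
    rw [zero_add] at h2
    rw [h2]
    rw [div_lt_iff₀ Real.two_pi_pos] at hq
    push_cast
    linarith
  have hbdd : ∃ b : ℤ, ∀ z : ℤ, θ y z < 0 → z ≤ b := by
    obtain ⟨q, hq⟩ := exists_nat_ge (-θ y 0 / (2 * Real.pi))
    refine ⟨q * (2 * B : ℕ), fun z hz => ?_⟩
    by_contra! hcon
    have h1 := hθ.mono y hcon.le
    have h2 := quasiperiodic_mul (hθ.period y) 0 q
    rw [zero_add] at h2
    rw [h2] at h1
    rw [div_le_iff₀ Real.two_pi_pos] at hq
    push_cast at h1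
    linarith
  -- With `p` the last index of negative phase, the phases of indices `p + 1, …, p + 2B` lie in `[0,
  -- 2π)`, so a factor `1 - e^{iθ}` vanishes at `μ` exactly when its phase is `0`.
  obtain ⟨p, hp, hpmax⟩ := Int.exists_greatest_of_bdd hbdd hbelow
  have hp1 : 0 ≤ θ y (p + 1) := by
    by_contra! hcon
    have := hpmax _ hcon
    omega
  have hpper := hθ.period y p
  have hpper1 := hθ.period y (p + 1)
  set Z : Finset ℕ := (Finset.range (2 * B)).filter fun j => θ y (j + (p + 1)) = 0 with hZ
  have hset : {n : ℤ | crossing θ 0 L n = μ}.encard = (Z.card : ℕ∞) := by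
    have himage : {n : ℤ | crossing θ 0 L n = μ} =
        (fun j : ℕ => -((j : ℤ) + (p + 1))) '' (Z : Set ℕ) := by
      ext n
      simp only [Set.mem_ofPred_eq, hθ.crossing_eq_iff hB hL, zero_add, Set.mem_image,
        Finset.mem_coe, hZ, Finset.mem_filter, Finset.mem_range, ← hy]
      constructor
      · intro hn
        have h1 : p < -n := by
          by_contra! hcon
          have := hθ.mono y hcon
          linarith
        have h2 : -n < p + 1 + (2 * B : ℕ) := by
          by_contra! hcon
          have := hθ.mono y hcon
          linarith [Real.pi_pos]
        refine ⟨(-n - (p + 1)).toNat, ⟨by omega, ?_⟩, by omega⟩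
        rw [show (((-n - (p + 1)).toNat : ℕ) : ℤ) + (p + 1) = -n by omega]
        exact hn
      · rintro ⟨j, ⟨-, hj⟩, rfl⟩
        rw [neg_neg]
        exact hj
    rw [himage, Function.Injective.encard_image, Set.encard_coe_eq_coe_finsetCard]
    intro i j hij
    simp only at hij
    omega
  rw [hset]
  refine (analyticOrderAt_eq_of_isTheta (analyticAt_secular S₀ L μ) ?_).symm
  have hprod : secular S₀ L = fun t => ∏ j ∈ Finset.range (2 * B),
      (1 - Complex.exp (Complex.I * (θ (t • L) (j + (p + 1)) : ℂ))) := by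
    funext t
    rw [secular, evolution, ((hlift (t • L)).shift (p + 1)).det_one_sub, hcard]
  have hpow : (fun t : ℝ => (t - μ) ^ Z.card) = fun t => ∏ j ∈ Finset.range (2 * B),
      if θ y (j + (p + 1)) = 0 then t - μ else 1 := by
    funext t
    rw [Finset.prod_ite, Finset.prod_const, Finset.prod_const_one, mul_one]
  rw [hprod, hpow]
  refine IsTheta.finsetProd fun j hj => ?_
  have hj := Finset.mem_range.1 hj
  split_ifs with h0
  · have key : ∀ t, a * |t - μ| ≤ |θ (t • L) (j + (p + 1))| ∧
        |θ (t • L) (j + (p + 1))| ≤ c * |t - μ| := by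
      intro t
      rcases le_total μ t with h | h
      · have h1 := hθ.slope_bounds hac haL hcL 0 (j + (p + 1)) h
        rw [zero_add, zero_add, ← hy, h0, sub_zero] at h1
        rw [abs_of_nonneg (sub_nonneg.2 h), abs_of_nonneg
          ((mul_nonneg ha.le (sub_nonneg.2 h)).trans h1.1)]
        exact h1
      · have h1 := hθ.slope_bounds hac haL hcL 0 (j + (p + 1)) h
        rw [zero_add, zero_add, ← hy, h0, zero_sub] at h1
        rw [abs_of_nonpos (sub_nonpos.2 h), neg_sub, abs_of_nonpos
          (neg_nonneg.1 ((mul_nonneg ha.le (sub_nonneg.2 h)).trans h1.1))]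
        exact h1
    exact isTheta_one_sub_exp ha (fun t => (key t).1) (fun t => (key t).2)
  · have hcont : Continuous fun t : ℝ =>
        1 - Complex.exp (Complex.I * (θ (t • L) (j + (p + 1)) : ℂ)) := by
      have h1 : Continuous fun t : ℝ => θ (t • L) (j + (p + 1)) :=
        (hθ.continuous _).comp (by fun_prop)
      exact continuous_const.sub (Complex.continuous_exp.comp
        (continuous_const.mul (Complex.continuous_ofReal.comp h1)))
    have hne : 1 - Complex.exp (Complex.I * (θ (μ • L) (j + (p + 1)) : ℂ)) ≠ 0 := by
      have hlow : 0 ≤ θ y (j + (p + 1)) := hp1.trans (hθ.mono y (by omega))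
      have hup : θ y (j + (p + 1)) ≤ θ y (p + (2 * B : ℕ)) := hθ.mono y (by omega)
      have hpos : 0 < θ y (j + (p + 1)) := lt_of_le_of_ne hlow (Ne.symm h0)
      rw [← norm_pos_iff, norm_sub_rev, Complex.norm_exp_I_mul_ofReal_sub_one, norm_pos_iff]
      exact mul_ne_zero two_ne_zero (Real.sin_pos_of_pos_of_lt_pi (by linarith) (by linarith)).ne'
    exact ⟨(hcont.tendsto μ).isBigO_one ℝ, (isBigO_const_left_iff_pos_le_norm one_ne_zero).2
        ⟨_, half_pos (norm_pos_iff.2 hne), (hcont.tendsto μ).norm.eventually_const_le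
          (half_lt_self (norm_pos_iff.2 hne))⟩⟩

end Multiplicity

/-! ### The enumeration of the spectrum: uniqueness, and existence through crossings. -/

section Spectrum

variable {B : ℕ} {S₀ : Matrix (Fin B ⊕ Fin B) (Fin B ⊕ Fin B) ℂ} {L : Fin B → ℝ}

/-- At a first disagreement of this kind, `lam` would take the value `lam n` strictly more often
than `lam'`, against the common finite multiplicity. -/
theorem IsLambdaSpectrum.not_lt_of_forall_lt {lam lam' : ℕ → ℝ} (h : IsLambdaSpectrum S₀ L lam)
    (h' : IsLambdaSpectrum S₀ L lam') (hfin : ∀ μ, analyticOrderAt (secular S₀ L) μ ≠ ⊤) {n : ℕ}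
    (hn : 1 ≤ n) (heq : ∀ k, 1 ≤ k → k < n → lam k = lam' k) : ¬ lam n < lam' n := by
  intro hlt
  have hcard := (h.multiplicity (lam n) (h.pos n hn)).trans
    (h'.multiplicity (lam n) (h.pos n hn)).symm
  have hfin' : {k : ℕ | 1 ≤ k ∧ lam k = lam n}.Finite := by
    rw [← Set.encard_ne_top_iff, h.multiplicity (lam n) (h.pos n hn)]
    exact hfin _
  have hlt' : ∀ k, 1 ≤ k → lam' k = lam n → k < n := by
    intro k _ hk'
    by_contra! hcon
    have := h'.mono n k hn hcon
    linarith
  have hss : {k : ℕ | 1 ≤ k ∧ lam' k = lam n} ⊂ {k : ℕ | 1 ≤ k ∧ lam k = lam n} := by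
    refine (Set.ssubset_iff_of_subset ?_).2 ⟨n, ⟨hn, rfl⟩, ?_⟩
    · rintro k ⟨hk, hk'⟩
      exact ⟨hk, (heq k hk (hlt' k hk hk')).trans hk'⟩
    · rintro ⟨-, hk'⟩
      exact lt_irrefl n (hlt' n hn hk')
  exact ((hfin'.subset hss.subset).encard_lt_encard hss).ne hcard.symm

theorem IsLambdaSpectrum.unique {lam lam' : ℕ → ℝ} (h : IsLambdaSpectrum S₀ L lam)
    (h' : IsLambdaSpectrum S₀ L lam') (hfin : ∀ μ, analyticOrderAt (secular S₀ L) μ ≠ ⊤) (n : ℕ)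
    (hn : 1 ≤ n) : lam n = lam' n := by
  induction n using Nat.strong_induction_on with
  | _ n ih =>
    have h1 := h.not_lt_of_forall_lt h' hfin hn (fun k hk hkn => ih k hkn hk)
    have h2 := h'.not_lt_of_forall_lt h hfin hn (fun k hk hkn => (ih k hkn hk).symm)
    exact le_antisymm (not_lt.1 h2) (not_lt.1 h1)

variable {θ : (Fin B → ℝ) → ℤ → ℝ}

theorem sum_pos_of_forall_pos (hB : 1 ≤ B) (hL : ∀ b, 0 < L b) : 0 < ∑ b, L b :=
  Finset.sum_pos (fun b _ => hL b) ⟨⟨0, hB⟩, Finset.mem_univ _⟩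

theorem IsPhaseFamily.exists_first_positive_crossing (hθ : IsPhaseFamily θ) (hB : 1 ≤ B)
    (hL : ∀ b, 0 < L b) (x : Fin B → ℝ) :
    ∃ n : ℤ, crossing θ x L n ≤ 0 ∧ 0 < crossing θ x L (n + 1) := by
  obtain ⟨C, hC⟩ := hθ.exists_abs_crossing_sub_le hB hL x
  have hs := sum_pos_of_forall_pos hB hL
  have hbdd : ∃ b : ℤ, ∀ z : ℤ, crossing θ x L z ≤ 0 → z ≤ b := by
    obtain ⟨q, hq⟩ := exists_nat_ge (C / Real.pi)
    refine ⟨q, fun z hz => ?_⟩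
    rw [div_le_iff₀ Real.pi_pos] at hq
    have h1 := (abs_le.1 (hC z)).1
    have h2 : crossing θ x L z * ∑ b, L b ≤ 0 := mul_nonpos_of_nonpos_of_nonneg hz hs.le
    have h3 : Real.pi * z ≤ Real.pi * q := by linarith
    exact_mod_cast le_of_mul_le_mul_left h3 Real.pi_pos
  have hinh : ∃ z : ℤ, crossing θ x L z ≤ 0 := by
    obtain ⟨q, hq⟩ := exists_nat_ge (C / Real.pi)
    rw [div_le_iff₀ Real.pi_pos] at hq
    refine ⟨-q, ?_⟩
    have h1 := (abs_le.1 (hC (-q))).2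
    push_cast at h1
    by_contra! hcon
    have := mul_pos hcon hs
    linarith
  obtain ⟨n, hn, hmax⟩ := Int.exists_greatest_of_bdd hbdd hinh
  refine ⟨n, hn, ?_⟩
  by_contra! hcon
  have := hmax _ hcon
  omega

theorem IsPhaseFamily.isLambdaSpectrum (hθ : IsPhaseFamily θ) (hB : 1 ≤ B)
    (hlift : ∀ x, IsPhaseLift (expDiag x * S₀) (θ x)) (hL : ∀ b, 0 < L b) {n₀ : ℤ}
    (h0 : crossing θ 0 L n₀ ≤ 0) (h1 : 0 < crossing θ 0 L (n₀ + 1)) :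
    IsLambdaSpectrum S₀ L fun n => crossing θ 0 L (n₀ + n) := by
  refine ⟨fun n hn => h1.trans_le (hθ.crossing_mono hB hL 0 (by omega)),
    fun m n _ hmn => hθ.crossing_mono hB hL 0 (by omega), fun μ hμ => ?_⟩
  rw [← analyticOrderAt_secular hB hθ hlift hL μ]
  have himage : {n : ℤ | crossing θ 0 L n = μ} =
      (fun n : ℕ => n₀ + (n : ℤ)) '' {n : ℕ | 1 ≤ n ∧ crossing θ 0 L (n₀ + n) = μ} := by
    ext n
    simp only [Set.mem_ofPred_eq, Set.mem_image]
    constructor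
    · intro hn
      have hlt : n₀ < n := by
        by_contra! hcon
        have := hθ.crossing_mono hB hL 0 hcon
        linarith
      refine ⟨(n - n₀).toNat, ⟨by omega, ?_⟩, by omega⟩
      rw [show n₀ + ((n - n₀).toNat : ℤ) = n by omega]
      exact hn
    · rintro ⟨k, ⟨-, hk⟩, rfl⟩
      exact hk
  rw [himage, Function.Injective.encard_image]
  intro i j hij
  simp only at hij
  omega

theorem IsPhaseFamily.analyticOrderAt_secular_ne_top (hθ : IsPhaseFamily θ) (hB : 1 ≤ B)
    (hlift : ∀ x, IsPhaseLift (expDiag x * S₀) (θ x)) (hL : ∀ b, 0 < L b) (μ : ℝ) :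
    analyticOrderAt (secular S₀ L) μ ≠ ⊤ := by
  rw [← analyticOrderAt_secular hB hθ hlift hL μ, Set.encard_ne_top_iff]
  obtain ⟨C, hC⟩ := hθ.exists_abs_crossing_sub_le hB hL 0
  obtain ⟨q, hq⟩ := exists_nat_ge ((C + |μ * ∑ b, L b|) / Real.pi)
  rw [div_le_iff₀ Real.pi_pos] at hq
  refine (Set.finite_Icc (-(q : ℤ)) q).subset fun n hn => ?_
  have h1 := abs_le.1 (hC n)
  rw [show crossing θ 0 L n = μ from hn] at h1
  have h2 : Real.pi * n ≤ Real.pi * q := by linarith [le_abs_self (μ * ∑ b, L b), h1.1]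
  have h3 : Real.pi * (-q) ≤ Real.pi * n := by linarith [neg_abs_le (μ * ∑ b, L b), h1.2]
  constructor
  · exact_mod_cast le_of_mul_le_mul_left h3 Real.pi_pos
  · exact_mod_cast le_of_mul_le_mul_left h2 Real.pi_pos

end Spectrum

/-! ### Replacing a sum over points by an integral of tents. -/

section Tent

/-- The tent function of height `1` supported on `[-1, 1]`. -/
def tent (s : ℝ) : ℝ := max 0 (1 - |s|)

theorem continuous_tent : Continuous tent := by
  unfold tent
  fun_prop

theorem tent_nonneg (s : ℝ) : 0 ≤ tent s := le_max_left _ _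

theorem tent_eq_zero {s : ℝ} (hs : 1 ≤ |s|) : tent s = 0 := max_eq_left (by linarith)

theorem abs_lt_one_of_tent_ne_zero {s : ℝ} (hs : tent s ≠ 0) : |s| < 1 := by
  by_contra! h
  exact hs (tent_eq_zero h)

theorem integral_tent : ∫ s in (-1 : ℝ)..1, tent s = 1 := by
  have hintegrable : ∀ a b : ℝ, IntervalIntegrable tent volume a b :=
    fun a b => continuous_tent.intervalIntegrable a b
  rw [← intervalIntegral.integral_add_adjacent_intervals (hintegrable (-1) 0) (hintegrable 0 1)]
  have h1 : ∫ s in (-1 : ℝ)..0, tent s = ∫ s in (-1 : ℝ)..0, (1 + s) := by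
    refine intervalIntegral.integral_congr fun s hs => ?_
    rw [Set.uIcc_of_le (by norm_num)] at hs
    simp only [tent]
    rw [abs_of_nonpos hs.2, max_eq_right (by linarith [hs.1])]
    ring
  have h2 : ∫ s in (0 : ℝ)..1, tent s = ∫ s in (0 : ℝ)..1, (1 - s) := by
    refine intervalIntegral.integral_congr fun s hs => ?_
    rw [Set.uIcc_of_le (by norm_num)] at hs
    simp only [tent]
    rw [abs_of_nonneg hs.1, max_eq_right (by linarith [hs.2])]
  rw [h1, h2, intervalIntegral.integral_add (by simp) (by simp),
    intervalIntegral.integral_sub (by simp) (by simp)]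
  simp only [intervalIntegral.integral_const, integral_id, smul_eq_mul]
  norm_num

theorem integral_tent_of_le {a b : ℝ} (ha : a ≤ -1) (hb : 1 ≤ b) : ∫ s in a..b, tent s = 1 := by
  have hintegrable : ∀ a b : ℝ, IntervalIntegrable tent volume a b :=
    fun a b => continuous_tent.intervalIntegrable a b
  have hzero : ∀ a b : ℝ, a ≤ b → (∀ s ∈ Set.Icc a b, 1 ≤ |s|) → ∫ s in a..b, tent s = 0 := by
    intro a b hab h
    rw [intervalIntegral.integral_congr (g := fun _ => (0 : ℝ)), intervalIntegral.integral_zero]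
    intro s hs
    rw [Set.uIcc_of_le hab] at hs
    exact tent_eq_zero (h s hs)
  rw [← intervalIntegral.integral_add_adjacent_intervals (hintegrable a (-1)) (hintegrable (-1) b),
    ← intervalIntegral.integral_add_adjacent_intervals (hintegrable (-1) 1) (hintegrable 1 b), integral_tent,
    hzero a (-1) ha fun s hs => le_abs.2 (Or.inr (by linarith [hs.2])),
    hzero 1 b hb fun s hs => le_abs.2 (Or.inl hs.1)]
  norm_num

theorem integral_tent_mem (a b : ℝ) (hab : a ≤ b) :
    0 ≤ ∫ s in a..b, tent s ∧ ∫ s in a..b, tent s ≤ 1 := by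
  refine ⟨intervalIntegral.integral_nonneg hab fun s _ => tent_nonneg s, ?_⟩
  rw [← integral_tent_of_le (min_le_right a (-1)) (le_max_right b 1)]
  refine intervalIntegral.integral_mono_interval (min_le_left _ _) hab (le_max_left _ _)
    (Eventually.of_forall fun s => tent_nonneg s) (continuous_tent.intervalIntegrable _ _)

/-- Summing the bounded weights `w n` over the points `ζ 1, …, ζ N` amounts, up to a bounded error,
to integrating over `[ζ 0, ζ N]` the weights smeared out by the tent function. -/
theorem exists_abs_integral_tent_sub_sum_le {ζ w : ℤ → ℝ} (hζ : Monotone ζ) {m : ℕ} {c : ℝ}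
    (hc : 0 < c) (hm : ∀ n, ζ n + c ≤ ζ (n + m)) {M : ℝ} (hw : ∀ n, |w n| ≤ M) :
    ∃ C : ℝ, ∀ N : ℕ, |(∫ t in ζ 0..ζ N, ∑ᶠ n : ℤ, tent (ζ n - t) * w n) -
      ∑ n ∈ Finset.Icc 1 N, w n| ≤ C := by
  have hM : 0 ≤ M := (abs_nonneg _).trans (hw 0)
  -- `K` indices suffice to advance by the half-width of a tent.
  obtain ⟨K, hK1, hK⟩ : ∃ K : ℕ, 1 ≤ K ∧ ∀ n, ζ n + 1 ≤ ζ (n + K) := by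
    obtain ⟨q, hq⟩ := exists_nat_ge (1 / c)
    rw [div_le_iff₀ hc] at hq
    have hq' : ∀ (q : ℕ) (n : ℤ), ζ n + q * c ≤ ζ (n + (q * m : ℕ)) := by
      intro q
      induction q with
      | zero => intro n; simp
      | succ q ih =>
        intro n
        have h1 := ih n
        have h2 := hm (n + (q * m : ℕ))
        rw [show n + ((q * m : ℕ) : ℤ) + m = n + ((q + 1) * m : ℕ) by push_cast; ring] at h2
        push_cast at h1 h2 ⊢
        linarith
    refine ⟨q * m + 1, by omega, fun n => ?_⟩
    have h1 := hq' q n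
    have h2 : ζ (n + (q * m : ℕ)) ≤ ζ (n + (q * m + 1 : ℕ)) := hζ (by omega)
    linarith
  refine ⟨∑ _n ∈ Finset.range (4 * K), M, fun N => ?_⟩
  have h0N : ζ 0 ≤ ζ N := hζ (by omega)
  set I : Finset ℤ := Finset.Ioo (-(K : ℤ)) (N + K) with hI
  have hfin : ∀ t ∈ Set.uIcc (ζ 0) (ζ N), ∑ᶠ n : ℤ, tent (ζ n - t) * w n =
      ∑ n ∈ I, tent (ζ n - t) * w n := by
    intro t ht
    rw [Set.uIcc_of_le h0N] at ht
    refine finsum_eq_sum_of_support_subset _ fun n hn => ?_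
    have hlt := abs_lt.1 (abs_lt_one_of_tent_ne_zero (left_ne_zero_of_mul hn))
    rw [Finset.mem_coe, hI, Finset.mem_Ioo]
    constructor
    · by_contra! hcon
      have h1 := hζ hcon
      have h2 := hK (-K)
      rw [neg_add_cancel] at h2
      linarith [ht.1, hlt.1]
    · by_contra! hcon
      have h1 := hζ hcon
      have h2 := hK N
      linarith [ht.2, hlt.2]
  set W : ℤ → ℝ := fun n => ∫ t in ζ 0..ζ N, tent (ζ n - t) with hW
  have hWtent : ∀ n, W n = ∫ s in (ζ n - ζ N)..(ζ n - ζ 0), tent s := fun n =>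
    intervalIntegral.integral_comp_sub_left (fun s => tent s) (ζ n)
  have hintegrable : ∫ t in ζ 0..ζ N, ∑ᶠ n : ℤ, tent (ζ n - t) * w n = ∑ n ∈ I, W n * w n := by
    rw [intervalIntegral.integral_congr hfin, intervalIntegral.integral_finsetSum]
    · exact Finset.sum_congr rfl fun n _ => intervalIntegral.integral_mul_const _ _
    · intro n _
      exact ((continuous_tent.comp (by fun_prop)).mul continuous_const).intervalIntegrable _ _
  have hsum : ∑ n ∈ Finset.Icc 1 N, w n = ∑ n ∈ I, (if 1 ≤ n ∧ n ≤ N then 1 else 0) * w n := by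
    simp only [ite_mul, one_mul, zero_mul]
    rw [← Finset.sum_filter]
    refine Finset.sum_bij (fun (n : ℕ) _ => (n : ℤ)) ?_ ?_ ?_ ?_
    · intro n hn
      rw [Finset.mem_Icc] at hn
      rw [Finset.mem_filter, hI, Finset.mem_Ioo]
      omega
    · intro i _ j _ hij
      exact_mod_cast hij
    · intro n hn
      rw [Finset.mem_filter] at hn
      exact ⟨n.toNat, by rw [Finset.mem_Icc]; omega, by omega⟩
    · intro n _
      rfl
  rw [hintegrable, hsum, ← Finset.sum_sub_distrib]
  refine (Finset.abs_sum_le_sum_abs _ _).trans ?_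
  -- A tent centred at least `K` indices inside the range lies wholly in the interval and integrates
  -- to `1`. Only the fewer than `4K` indices near the two ends contribute an error, each at most
  -- `M`.
  have hterm : ∀ n ∈ I, |W n * w n - (if 1 ≤ n ∧ n ≤ (N : ℤ) then 1 else 0) * w n| ≤
      if n < K ∨ N - K < n then M else 0 := by
    intro n _
    rw [← sub_mul, abs_mul]
    split_ifs with h1 h2 h2
    · have hb := integral_tent_mem (ζ n - ζ N) (ζ n - ζ 0) (by linarith)
      rw [← hWtent] at hb
      calc |W n - 1| * |w n| ≤ 1 * M := by
            refine mul_le_mul ?_ (hw n) (abs_nonneg _) zero_le_one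
            rw [abs_le]; constructor <;> linarith [hb.1, hb.2]
        _ = M := one_mul M
    · push Not at h2
      have e1 : ζ 0 + 1 ≤ ζ n := by
        have := hK 0
        rw [zero_add] at this
        exact this.trans (hζ h2.1)
      have e2 : ζ n + 1 ≤ ζ N := (hK n).trans (hζ (by omega))
      rw [hWtent, integral_tent_of_le (by linarith) (by linarith), sub_self, abs_zero, zero_mul]
    · have hb := integral_tent_mem (ζ n - ζ N) (ζ n - ζ 0) (by linarith)
      rw [← hWtent] at hb
      calc |W n - 0| * |w n| ≤ 1 * M := by
            refine mul_le_mul ?_ (hw n) (abs_nonneg _) zero_le_one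
            rw [abs_le]; constructor <;> linarith [hb.1, hb.2]
        _ = M := one_mul M
    · exfalso
      omega
  refine (Finset.sum_le_sum hterm).trans ?_
  rw [← Finset.sum_filter, Finset.sum_const, Finset.sum_const, Finset.card_range]
  refine nsmul_le_nsmul_left hM ?_
  have hsub : (I.filter fun n : ℤ => n < K ∨ N - K < n) ⊆
      Finset.Ioo (-(K : ℤ)) K ∪ Finset.Ioo ((N : ℤ) - K) (N + K) := by
    intro n hn
    rw [Finset.mem_filter, hI, Finset.mem_Ioo] at hn
    rw [Finset.mem_union, Finset.mem_Ioo, Finset.mem_Ioo]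
    omega
  refine (Finset.card_le_card hsub).trans ((Finset.card_union_le _ _).trans ?_)
  rw [Int.card_Ioo, Int.card_Ioo]
  omega

end Tent

/-! ### The smeared level statistic as a continuous function of position and bond lengths. -/

section Flux

variable {B : ℕ} {θ : (Fin B → ℝ) → ℤ → ℝ}

/-- The value of `h` at the scaled spacing between consecutive crossings. -/
def spacingValue (θ : (Fin B → ℝ) → ℤ → ℝ) (h : ℝ → ℝ) (x L : Fin B → ℝ) (n : ℤ) : ℝ :=
  h (meanLength L * (crossing θ x L n - crossing θ x L (n - 1)))

/-- The sum over all crossings of the orbit `t ↦ x + t L`, weighted by the tent function, of the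
values of `h` at the scaled spacings. -/
def flux (θ : (Fin B → ℝ) → ℤ → ℝ) (h : ℝ → ℝ) (x L : Fin B → ℝ) : ℝ :=
  ∑ᶠ n : ℤ, tent (crossing θ x L n) * spacingValue θ h x L n

theorem IsPhaseFamily.flux_add_smul (hθ : IsPhaseFamily θ) (hB : 1 ≤ B) {L : Fin B → ℝ}
    (hL : ∀ b, 0 < L b) (h : ℝ → ℝ) (x : Fin B → ℝ) (t : ℝ) :
    flux θ h (x + t • L) L =
      ∑ᶠ n : ℤ, tent (crossing θ x L n - t) * spacingValue θ h x L n := by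
  simp only [flux, spacingValue, hθ.crossing_add_smul hB hL, sub_sub_sub_cancel_right]

theorem IsPhaseFamily.flux_add_single (hθ : IsPhaseFamily θ) (hB : 1 ≤ B) {L : Fin B → ℝ}
    (hL : ∀ b, 0 < L b) (h : ℝ → ℝ) (x : Fin B → ℝ) (b : Fin B) :
    flux θ h (x + Pi.single b (2 * Real.pi)) L = flux θ h x L := by
  simp only [flux, spacingValue, hθ.crossing_add_single hB hL]
  conv_rhs => rw [← finsum_comp_equiv (Equiv.subRight (2 : ℤ))]
  simp only [Equiv.subRight_apply, sub_right_comm]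

theorem IsPhaseFamily.finite_abs_le (hθ : IsPhaseFamily θ) (x : Fin B → ℝ) (R : ℝ) :
    {n : ℤ | |θ x (-n)| ≤ R}.Finite := by
  obtain ⟨q, hq⟩ := exists_nat_gt ((R + |θ x 0|) / (2 * Real.pi))
  rw [div_lt_iff₀ Real.two_pi_pos] at hq
  refine (Set.finite_Icc (-(q * (2 * B : ℕ) : ℤ)) (q * (2 * B : ℕ))).subset fun n hn => ?_
  have hn' := abs_le.1 (show |θ x (-n)| ≤ R from hn)
  have h1 := quasiperiodic_mul (hθ.period x) 0 q
  have h2 := quasiperiodic_mul (hθ.period x) 0 (-q : ℤ)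
  rw [zero_add] at h1 h2
  rw [Set.mem_Icc]
  push_cast at h1 h2
  constructor
  · by_contra! hcon
    have := hθ.mono x (show (q : ℤ) * (2 * B : ℕ) ≤ -n by linarith)
    push_cast at this
    linarith [neg_abs_le (θ x 0)]
  · by_contra! hcon
    have := hθ.mono x (show -n ≤ -(q : ℤ) * (2 * B : ℕ) by linarith)
    push_cast at this
    linarith [le_abs_self (θ x 0)]

theorem continuous_meanLength : Continuous (meanLength : (Fin B → ℝ) → ℝ) := by
  unfold meanLength
  fun_prop

/-- The sum is locally finite: for `(x', L')` within distance `1` of `(x, L)`, a crossing of index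
`n` at a time in `(-1, 1)` forces `|θ x (-n)| ≤ 2 + ‖L‖`. Continuity jointly with `L` is what
permits the passage to equal lengths. -/
theorem IsPhaseFamily.continuous_flux (hθ : IsPhaseFamily θ) (hB : 1 ≤ B) {h : ℝ → ℝ}
    (hh : Continuous h) :
    Continuous fun p : (Fin B → ℝ) × PositiveLengths B => flux θ h p.1 p.2.1 := by
  refine continuous_finsum (fun n => ?_) ?_
  · refine (continuous_tent.comp (hθ.continuous_crossing hB n)).mul (hh.comp ?_)
    exact (continuous_meanLength.comp (continuous_subtype_val.comp continuous_snd)).mul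
      ((hθ.continuous_crossing hB n).sub (hθ.continuous_crossing hB (n - 1)))
  · rintro ⟨x, L⟩
    refine ⟨{p | ‖p.1 - x‖ < 1} ∩ {p | ‖p.2.1 - L.1‖ < 1}, ?_, ?_⟩
    · exact ((isOpen_lt (by fun_prop) continuous_const).inter
        (isOpen_lt (by fun_prop) continuous_const)).mem_nhds (by simp)
    · refine (hθ.finite_abs_le x (2 + ‖L.1‖)).subset ?_
      rintro n ⟨⟨x', L'⟩, hn, hx', hL'⟩
      have ht := abs_lt_one_of_tent_ne_zero (left_ne_zero_of_mul hn)
      have h1 := hθ.lipschitz x (x' + crossing θ x' L'.1 n • L'.1) (-n)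
      rw [hθ.crossing_spec hB L'.2, sub_zero] at h1
      refine h1.trans ?_
      have h2 : ‖x - (x' + crossing θ x' L'.1 n • L'.1)‖ ≤
          ‖x' - x‖ + |crossing θ x' L'.1 n| * ‖L'.1‖ := by
        rw [norm_sub_rev, add_sub_right_comm, ← Real.norm_eq_abs, ← norm_smul]
        exact norm_add_le _ _
      have h3 : ‖L'.1‖ ≤ ‖L.1‖ + 1 := by
        have := norm_add_le (L'.1 - L.1) L.1
        rw [sub_add_cancel] at this
        linarith [show ‖L'.1 - L.1‖ < 1 from hL']
      have h4 : |crossing θ x' L'.1 n| * ‖L'.1‖ ≤ 1 * ‖L'.1‖ :=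
        mul_le_mul_of_nonneg_right ht.le (norm_nonneg _)
      linarith [show ‖x' - x‖ < 1 from hx']

end Flux

/-! ### Descent to the torus and equidistribution of the linear flow. -/

section Torus

variable {B : ℕ}

/-- The projection of `ℝ^B` to the torus with coordinates of period `2π`. -/
def toTorus (x : Fin B → ℝ) : UnitAddTorus (Fin B) := fun b => ((x b / (2 * Real.pi) : ℝ) : UnitAddCircle)

theorem toTorus_add (x y : Fin B → ℝ) : toTorus (x + y) = toTorus x + toTorus y := by
  funext b
  simp [toTorus, add_div]

theorem isOpenQuotientMap_toTorus : IsOpenQuotientMap (toTorus (B := B)) := by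
  have h : ∀ _ : Fin B, IsOpenQuotientMap fun r : ℝ => ((r / (2 * Real.pi) : ℝ) : UnitAddCircle) := by
    intro _
    have h1 : IsOpenQuotientMap ((↑) : ℝ → UnitAddCircle) :=
      QuotientAddGroup.isOpenQuotientMap_mk
    have h2 : IsOpenQuotientMap fun r : ℝ => r / (2 * Real.pi) :=
      (Homeomorph.mulRight₀ (2 * Real.pi)⁻¹ (inv_ne_zero Real.two_pi_pos.ne')).isOpenQuotientMap
    exact h1.comp h2
  exact IsOpenQuotientMap.piMap h

/-- A function with period `2π` in each coordinate is constant on the fibres of the projection to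
the torus. -/
theorem eq_of_toTorus_eq {f : (Fin B → ℝ) → ℝ}
    (hf : ∀ x b, f (x + Pi.single b (2 * Real.pi)) = f x) {x y : Fin B → ℝ}
    (hxy : toTorus x = toTorus y) : f x = f y := by
  have hk : ∀ b, ∃ k : ℤ, x b = y b + k * (2 * Real.pi) := by
    intro b
    have h1 : ((x b / (2 * Real.pi) : ℝ) : UnitAddCircle) = ((y b / (2 * Real.pi) : ℝ) : UnitAddCircle) :=
      congrFun hxy b
    rw [← sub_eq_zero, ← AddCircle.coe_sub, AddCircle.coe_eq_zero_iff] at h1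
    obtain ⟨k, hk⟩ := h1
    refine ⟨k, ?_⟩
    rw [zsmul_eq_mul, mul_one] at hk
    have := Real.pi_pos
    field_simp at hk
    linarith
  choose k hk using hk
  have hper : ∀ b, Function.Periodic f (Pi.single b (2 * Real.pi)) := fun b x => hf x b
  have hsum : ∀ s : Finset (Fin B), f (y + ∑ b ∈ s, k b • Pi.single b (2 * Real.pi)) = f y := by
    intro s
    induction s using Finset.induction_on with
    | empty => simp
    | insert b s hb ih =>
      rw [Finset.sum_insert hb, add_comm (k b • _), ← add_assoc, (hper b).zsmul (k b), ih]
  have hx : x = y + ∑ b, k b • Pi.single b (2 * Real.pi) := by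
    funext b
    rw [hk b, Pi.add_apply, Finset.sum_apply]
    congr 1
    simp [Pi.single_apply]
  rw [hx, hsum]

/-- The function on the torus defined by a function with period `2π` in each coordinate. -/
def onTorus (f : (Fin B → ℝ) → ℝ) (τ : UnitAddTorus (Fin B)) : ℝ :=
  f (Function.surjInv (isOpenQuotientMap_toTorus (B := B)).surjective τ)

theorem onTorus_toTorus {f : (Fin B → ℝ) → ℝ}
    (hf : ∀ x b, f (x + Pi.single b (2 * Real.pi)) = f x) (x : Fin B → ℝ) :
    onTorus f (toTorus x) = f x :=
  eq_of_toTorus_eq hf (Function.surjInv_eq _ _)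

/-- The projection is an open quotient map, hence so is its product with the identity of the
parameter space, and joint continuity descends. -/
theorem continuous_onTorus {X : Type*} [TopologicalSpace X] {F : X → (Fin B → ℝ) → ℝ}
    (hF : Continuous fun p : (Fin B → ℝ) × X => F p.2 p.1)
    (hper : ∀ a x b, F a (x + Pi.single b (2 * Real.pi)) = F a x) :
    Continuous fun p : X × UnitAddTorus (Fin B) => onTorus (F p.1) p.2 := by
  rw [← ((IsOpenQuotientMap.id (X := X)).prodMap
    (isOpenQuotientMap_toTorus (B := B))).continuous_comp_iff]
  have h : ((fun p : X × UnitAddTorus (Fin B) => onTorus (F p.1) p.2) ∘ Prod.map id toTorus) =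
      fun p : X × (Fin B → ℝ) => F p.1 p.2 := by
    funext p
    exact onTorus_toTorus (hper p.1) p.2
  rw [h]
  exact hF.comp continuous_swap

instance isProbabilityMeasure_volume_torus :
    IsProbabilityMeasure (volume : Measure (UnitAddTorus (Fin B))) := by
  have : IsProbabilityMeasure (volume : Measure UnitAddCircle) := ⟨UnitAddCircle.measure_univ⟩
  exact inferInstanceAs (IsProbabilityMeasure (Measure.pi fun _ : Fin B => (volume : Measure UnitAddCircle)))

theorem mFourier_add_apply (n : Fin B → ℤ) (σ τ : UnitAddTorus (Fin B)) :
    UnitAddTorus.mFourier n (σ + τ) = UnitAddTorus.mFourier n σ * UnitAddTorus.mFourier n τ := by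
  simp only [UnitAddTorus.mFourier, ContinuousMap.coe_mk, ← Finset.prod_mul_distrib]
  refine Finset.prod_congr rfl fun b _ => ?_
  simp [fourier_apply, AddCircle.toCircle_add]

theorem mFourier_toTorus_smul (n : Fin B → ℤ) (L : Fin B → ℝ) (t : ℝ) :
    UnitAddTorus.mFourier n (toTorus (t • L)) =
      Complex.exp (((∑ b, (n b : ℝ) * L b : ℝ) : ℂ) * Complex.I * t) := by
  simp only [UnitAddTorus.mFourier, ContinuousMap.coe_mk, toTorus, fourier_coe_apply]
  rw [← Complex.exp_sum]
  congr 1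
  push_cast
  rw [Finset.sum_mul, Finset.sum_mul]
  refine Finset.sum_congr rfl fun b _ => ?_
  have : (Real.pi : ℂ) ≠ 0 := by exact_mod_cast Real.pi_ne_zero
  simp only [Pi.smul_apply, smul_eq_mul]
  push_cast
  field_simp

theorem sum_int_mul_ne_zero {L : Fin B → ℝ} (hL : LinearIndependent ℚ L) {n : Fin B → ℤ}
    (hn : n ≠ 0) : ∑ b, (n b : ℝ) * L b ≠ 0 := by
  intro h
  apply hn
  rw [Fintype.linearIndependent_iff] at hL
  funext b
  have := hL (fun b => (n b : ℚ)) (by simpa [Rat.smul_def] using h) b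
  exact_mod_cast this

/-- Translation along the flow for the time `π / ω` multiplies the character by `-1` and preserves
the measure. -/
theorem integral_mFourier {L : Fin B → ℝ} (hL : LinearIndependent ℚ L) {n : Fin B → ℤ}
    (hn : n ≠ 0) : ∫ τ, UnitAddTorus.mFourier n τ = 0 := by
  set ω := ∑ b, (n b : ℝ) * L b with hω
  have hω0 : ω ≠ 0 := sum_int_mul_ne_zero hL hn
  have h1 : UnitAddTorus.mFourier n (toTorus ((Real.pi / ω) • L)) = -1 := by
    rw [mFourier_toTorus_smul, ← hω, ← Complex.exp_pi_mul_I]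
    congr 1
    have : (ω : ℂ) ≠ 0 := by exact_mod_cast hω0
    push_cast
    field_simp
  have h2 := integral_add_left_eq_self (μ := (volume : Measure (UnitAddTorus (Fin B))))
    (fun τ => UnitAddTorus.mFourier n τ) (toTorus ((Real.pi / ω) • L))
  simp only [mFourier_add_apply, h1, neg_one_mul] at h2
  rw [integral_neg] at h2
  exact self_eq_neg.1 h2.symm

theorem continuous_toTorus : Continuous (toTorus (B := B)) := isOpenQuotientMap_toTorus.continuous

theorem continuous_comp_flow (f : C(UnitAddTorus (Fin B), ℂ)) (L : Fin B → ℝ) :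
    Continuous fun t : ℝ => f (toTorus (t • L)) :=
  f.continuous.comp (continuous_toTorus.comp (by fun_prop))

theorem tendsto_average_mFourier {L : Fin B → ℝ} (hL : LinearIndependent ℚ L) (n : Fin B → ℤ) :
    Tendsto (fun T : ℝ => (1 / T : ℂ) * ∫ t in (0 : ℝ)..T, UnitAddTorus.mFourier n (toTorus (t • L)))
      atTop (𝓝 (∫ τ, UnitAddTorus.mFourier n τ)) := by
  by_cases hn : n = 0
  · subst hn
    refine tendsto_const_nhds.congr' ?_
    filter_upwards [eventually_gt_atTop 0] with T hT
    have : (T : ℂ) ≠ 0 := by exact_mod_cast hT.ne'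
    simp [UnitAddTorus.mFourier_zero, this]
  · rw [integral_mFourier hL hn]
    set ω := ∑ b, (n b : ℝ) * L b with hω
    have hω0 : ω ≠ 0 := sum_int_mul_ne_zero hL hn
    have hωI : (ω : ℂ) * Complex.I ≠ 0 :=
      mul_ne_zero (by exact_mod_cast hω0) Complex.I_ne_zero
    have hb : ∀ᶠ T : ℝ in atTop, ‖(1 / T : ℂ) *
        ∫ t in (0 : ℝ)..T, UnitAddTorus.mFourier n (toTorus (t • L))‖ ≤ 2 / |ω| * T⁻¹ := by
      filter_upwards [eventually_gt_atTop 0] with T hT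
      simp only [mFourier_toTorus_smul, ← hω]
      rw [integral_exp_mul_complex hωI, norm_mul, norm_div, norm_div, norm_mul, Complex.norm_I,
        mul_one, Complex.norm_real, Complex.norm_real, norm_one, Real.norm_eq_abs, Real.norm_eq_abs,
        abs_of_pos hT]
      have h2 : ‖Complex.exp (ω * Complex.I * T) - Complex.exp (ω * Complex.I * (0 : ℝ))‖ ≤ 2 := by
        refine (norm_sub_le _ _).trans ?_
        rw [show (ω : ℂ) * Complex.I * T = ((ω * T : ℝ) : ℂ) * Complex.I by push_cast; ring,
          Complex.norm_exp_ofReal_mul_I]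
        simp
        norm_num
      rw [one_div, mul_comm]
      gcongr
    refine squeeze_zero_norm' hb ?_
    simpa using tendsto_inv_atTop_zero.const_mul (2 / |ω|)

/-- Equidistribution of the linear flow on the torus, for complex functions. -/
theorem tendsto_average_complex {L : Fin B → ℝ} (hL : LinearIndependent ℚ L)
    (f : C(UnitAddTorus (Fin B), ℂ)) :
    Tendsto (fun T : ℝ => (1 / T : ℂ) * ∫ t in (0 : ℝ)..T, f (toTorus (t • L)))
      atTop (𝓝 (∫ τ, f τ)) := by
  have hintegrable : ∀ g : C(UnitAddTorus (Fin B), ℂ), Integrable (fun τ => g τ) volume := fun g =>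
    g.continuous.integrable_of_hasCompactSupport (HasCompactSupport.of_compactSpace _)
  have hii : ∀ (g : C(UnitAddTorus (Fin B), ℂ)) (T : ℝ),
      IntervalIntegrable (fun t : ℝ => g (toTorus (t • L))) volume 0 T := fun g T =>
    (continuous_comp_flow g L).intervalIntegrable _ _
  -- Weyl's criterion: the limit holds for trigonometric polynomials, which are uniformly dense.
  have hspan : ∀ g ∈ Submodule.span ℂ (Set.range (UnitAddTorus.mFourier (d := Fin B))),
      Tendsto (fun T : ℝ => (1 / T : ℂ) * ∫ t in (0 : ℝ)..T, g (toTorus (t • L)))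
        atTop (𝓝 (∫ τ, g τ)) := by
    intro g hg
    induction hg using Submodule.span_induction with
    | mem g hg => obtain ⟨n, rfl⟩ := hg; exact tendsto_average_mFourier hL n
    | zero => simp
    | add g₁ g₂ _ _ h₁ h₂ =>
      simp only [ContinuousMap.add_apply]
      rw [integral_add (hintegrable g₁) (hintegrable g₂)]
      refine (h₁.add h₂).congr fun T => ?_
      rw [intervalIntegral.integral_add (hii g₁ T) (hii g₂ T)]
      ring
    | smul a g _ h =>
      simp only [ContinuousMap.smul_apply, smul_eq_mul]
      rw [integral_const_mul]
      refine (h.const_mul a).congr fun T => ?_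
      rw [intervalIntegral.integral_const_mul]
      ring
  rw [Metric.tendsto_nhds]
  intro ε hε
  have hf : f ∈ closure (Submodule.span ℂ (Set.range (UnitAddTorus.mFourier (d := Fin B))) :
      Set C(UnitAddTorus (Fin B), ℂ)) := by
    rw [← Submodule.topologicalClosure_coe, UnitAddTorus.span_mFourier_closure_eq_top]
    trivial
  obtain ⟨g, hg, hfg⟩ := Metric.mem_closure_iff.1 hf (ε / 3) (by positivity)
  have hbound : ∀ τ, ‖f τ - g τ‖ ≤ ε / 3 := by
    intro τ
    rw [← dist_eq_norm]
    exact (ContinuousMap.dist_apply_le_dist τ).trans hfg.le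
  filter_upwards [(Metric.tendsto_nhds.1 (hspan g hg)) (ε / 3) (by positivity),
    eventually_gt_atTop 0] with T hT hT0
  have h1 : ‖(1 / T : ℂ) * (∫ t in (0 : ℝ)..T, f (toTorus (t • L))) -
      (1 / T : ℂ) * ∫ t in (0 : ℝ)..T, g (toTorus (t • L))‖ ≤ ε / 3 := by
    rw [← mul_sub, ← intervalIntegral.integral_sub (hii f T) (hii g T), norm_mul]
    have := intervalIntegral.norm_integral_le_of_norm_le_const (a := 0) (b := T)
      (f := fun t : ℝ => f (toTorus (t • L)) - g (toTorus (t • L))) (C := ε / 3)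
      (fun t _ => hbound _)
    rw [sub_zero, abs_of_pos hT0] at this
    rw [norm_div, norm_one, Complex.norm_real, Real.norm_eq_abs, abs_of_pos hT0, one_div,
      inv_mul_le_iff₀ hT0]
    linarith
  have h2 : ‖(∫ τ, g τ) - ∫ τ, f τ‖ ≤ ε / 3 := by
    rw [← integral_sub (hintegrable g) (hintegrable f)]
    have := norm_integral_le_of_norm_le_const (μ := (volume : Measure (UnitAddTorus (Fin B))))
      (f := fun τ => g τ - f τ) (C := ε / 3)
      (Eventually.of_forall fun τ => by rw [norm_sub_rev]; exact hbound τ)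
    simpa using this
  rw [dist_eq_norm] at hT ⊢
  calc _ = ‖((1 / T : ℂ) * (∫ t in (0 : ℝ)..T, f (toTorus (t • L))) -
      (1 / T : ℂ) * ∫ t in (0 : ℝ)..T, g (toTorus (t • L))) +
      ((1 / T : ℂ) * (∫ t in (0 : ℝ)..T, g (toTorus (t • L))) - ∫ τ, g τ) +
      ((∫ τ, g τ) - ∫ τ, f τ)‖ := by congr 1; ring
    _ ≤ _ := norm_add₃_le
    _ < ε := by linarith

/-- Equidistribution of the linear flow on the torus. -/
theorem tendsto_average_of_periodic {L : Fin B → ℝ} (hL : LinearIndependent ℚ L)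
    {f : (Fin B → ℝ) → ℝ} (hf : Continuous f)
    (hper : ∀ x b, f (x + Pi.single b (2 * Real.pi)) = f x) :
    Tendsto (fun T : ℝ => (1 / T) * ∫ t in (0 : ℝ)..T, f (t • L)) atTop (𝓝 (∫ τ, onTorus f τ)) := by
  have hc : Continuous (onTorus f) :=
    (continuous_onTorus (X := Unit) (F := fun _ => f) (hf.comp continuous_fst)
      (fun _ => hper)).comp (Continuous.prodMk_right ())
  have h := tendsto_average_complex hL ⟨fun τ => (onTorus f τ : ℂ), by fun_prop⟩
  simp only [ContinuousMap.coe_mk, onTorus_toTorus hper] at h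
  rw [integral_complex_ofReal] at h
  simp only [intervalIntegral.integral_ofReal] at h
  have h2 := (Complex.continuous_re.tendsto _).comp h
  rw [Complex.ofReal_re] at h2
  refine h2.congr fun T => ?_
  simp only [Function.comp_apply]
  rw [← Complex.ofReal_one, ← Complex.ofReal_div, ← Complex.ofReal_mul, Complex.ofReal_re]

end Torus

/-! ### The limit functionals for eigenphases and for levels. -/

section Functionals

/-- A limit of linear functionals that are bounded by the supremum over a fixed compact set is
linear and continuous for uniform convergence on compact sets. -/
theorem exists_continuousLinearMap_of_tendsto {ι : Type*} {l : Filter ι} [l.NeBot]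
    {M : ι → C(ℝ, ℝ) → ℝ} {P : C(ℝ, ℝ) → ℝ} {K : Set ℝ} (hK : IsCompact K)
    (hP : ∀ h, Tendsto (fun i => M i h) l (𝓝 (P h)))
    (hadd : ∀ i g h, M i (g + h) = M i g + M i h) (hsmul : ∀ i (a : ℝ) h, M i (a • h) = a * M i h)
    (hbound : ∀ h C, (∀ s ∈ K, |h s| ≤ C) → ∀ᶠ i in l, |M i h| ≤ C) :
    ∃ Φ : C(ℝ, ℝ) →L[ℝ] ℝ, (∀ h, Φ h = P h) ∧ ∀ h C, (∀ s ∈ K, |h s| ≤ C) → |Φ h| ≤ C := by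
  have hPbound : ∀ h C, (∀ s ∈ K, |h s| ≤ C) → |P h| ≤ C := fun h C hC =>
    le_of_tendsto (hP h).abs (hbound h C hC)
  let Φ : C(ℝ, ℝ) →ₗ[ℝ] ℝ :=
    { toFun := P
      map_add' := fun g h => tendsto_nhds_unique (hP (g + h))
        (((hP g).add (hP h)).congr fun i => (hadd i g h).symm)
      map_smul' := fun a h => tendsto_nhds_unique (hP (a • h))
        (((hP h).const_mul a).congr fun i => (hsmul i a h).symm) }
  have hΦ : Continuous Φ := by
    refine continuous_of_continuousAt_zero Φ ?_
    rw [ContinuousAt, map_zero, Metric.tendsto_nhds]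
    intro ε hε
    have hopen := ContinuousMap.isOpen_setOfPred_mapsTo (X := ℝ) (Y := ℝ) hK
      (Metric.isOpen_ball (x := (0 : ℝ)) (ε := ε / 2))
    filter_upwards [hopen.mem_nhds (x := 0) fun s _ => by simpa using hε] with h hh
    rw [dist_zero_right, Real.norm_eq_abs]
    refine (hPbound h (ε / 2) fun s hs => ?_).trans_lt (half_lt_self hε)
    have := hh hs
    rw [mem_ball_zero_iff, Real.norm_eq_abs] at this
    exact this.le
  exact ⟨⟨Φ, hΦ⟩, fun h => rfl, hPbound⟩

theorem tendsto_div_of_abs_sub_le {S A : ℕ → ℝ} {C p : ℝ} (hSA : ∀ N, |S N - A N| ≤ C)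
    (hA : Tendsto (fun N : ℕ => (1 / (N : ℝ)) * A N) atTop (𝓝 p)) :
    Tendsto (fun N : ℕ => (1 / (N : ℝ)) * S N) atTop (𝓝 p) := by
  have h0 : Tendsto (fun N : ℕ => (1 / (N : ℝ)) * (S N - A N)) atTop (𝓝 0) := by
    refine squeeze_zero_norm (a := fun N : ℕ => C / (N : ℝ)) (fun N => ?_)
      (tendsto_const_div_atTop_nhds_zero_nat C)
    rw [norm_mul, Real.norm_eq_abs, Real.norm_eq_abs, abs_of_nonneg (by positivity),
      one_div_mul_eq_div]
    exact div_le_div_of_nonneg_right (hSA N) (by positivity)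
  have := hA.add h0
  rw [add_zero] at this
  exact this.congr fun N => by ring

theorem sum_Icc_one_eq_sum_range {M : Type*} [AddCommMonoid M] (f : ℕ → M) (N : ℕ) :
    ∑ n ∈ Finset.Icc 1 N, f n = ∑ i ∈ Finset.range N, f (i + 1) := by
  induction N with
  | zero => simp
  | succ N ih => rw [Finset.sum_Icc_succ_top (by omega), Finset.sum_range_succ, ih]

variable {B : ℕ} {θ : (Fin B → ℝ) → ℤ → ℝ} {S₀ : Matrix (Fin B ⊕ Fin B) (Fin B ⊕ Fin B) ℂ}

/-- The mean of `h` over the cyclic spacings of the eigenphases. -/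
def spacingMean (θ : (Fin B → ℝ) → ℤ → ℝ) (h : ℝ → ℝ) (x : Fin B → ℝ) : ℝ :=
  (1 / (2 * B : ℝ)) * ∑ j ∈ Finset.range (2 * B), h (θ x (j + 1) - θ x j)

theorem IsPhaseFamily.spacing_periodic (hθ : IsPhaseFamily θ) (h : ℝ → ℝ) (x : Fin B → ℝ) (j : ℤ) :
    h (θ x (j + (2 * B : ℕ) + 1) - θ x (j + (2 * B : ℕ))) = h (θ x (j + 1) - θ x j) := by
  rw [add_right_comm, hθ.period, hθ.period]
  congr 1
  ring

theorem IsPhaseFamily.continuous_spacingMean (hθ : IsPhaseFamily θ) {h : ℝ → ℝ}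
    (hh : Continuous h) : Continuous (spacingMean θ h) := by
  refine continuous_const.mul (continuous_finsetSum _ fun j _ => hh.comp ?_)
  exact (hθ.continuous _).sub (hθ.continuous _)

theorem IsPhaseFamily.spacingMean_add_single (hθ : IsPhaseFamily θ) (h : ℝ → ℝ) (x : Fin B → ℝ)
    (b : Fin B) : spacingMean θ h (x + Pi.single b (2 * Real.pi)) = spacingMean θ h x := by
  simp only [spacingMean, hθ.add_single]
  congr 1
  rw [← sum_range_int_shift_of_periodic (f := fun j : ℤ => h (θ x (j + 1) - θ x j))
    (hθ.spacing_periodic h x) 2]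
  exact Finset.sum_congr rfl fun j _ => by rw [add_right_comm]

theorem IsPhaseFamily.abs_spacingMean_le (hθ : IsPhaseFamily θ) (hB : 1 ≤ B) {h : ℝ → ℝ} {C : ℝ}
    (hC : ∀ s ∈ Set.Icc 0 (2 * Real.pi), |h s| ≤ C) (x : Fin B → ℝ) : |spacingMean θ h x| ≤ C := by
  have hB' : (0 : ℝ) < 2 * B := by exact_mod_cast (by omega : 0 < 2 * B)
  rw [spacingMean, abs_mul, abs_of_nonneg (by positivity), one_div, inv_mul_le_iff₀ hB']
  have hj : ∀ j ∈ Finset.range (2 * B), |h (θ x (j + 1) - θ x j)| ≤ C := by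
    intro j _
    refine hC _ ⟨sub_nonneg.2 (hθ.mono x (by omega)), ?_⟩
    have h1 : θ x (j + 1) ≤ θ x (j + (2 * B : ℕ)) := hθ.mono x (by omega)
    rw [hθ.period] at h1
    linarith
  refine (Finset.abs_sum_le_sum_abs _ _).trans ((Finset.sum_le_sum hj).trans ?_)
  simp

theorem phaseSpacingAverage_eq (hB : 1 ≤ B) (hS₀ : S₀ ∈ Matrix.unitaryGroup (Fin B ⊕ Fin B) ℂ)
    (hlift : ∀ x, IsPhaseLift (expDiag x * S₀) (θ x)) (L : Fin B → ℝ) (h : ℝ → ℝ) (t : ℝ) :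
    phaseSpacingAverage S₀ L h t = spacingMean θ h (t • L) := by
  have : Nonempty (Fin B ⊕ Fin B) := ⟨Sum.inl ⟨0, hB⟩⟩
  have hcard : Fintype.card (Fin B ⊕ Fin B) = 2 * B := by
    rw [Fintype.card_sum, Fintype.card_fin]; ring
  have hsum := (hlift (t • L)).sum_phaseSpacing (mul_mem (expDiag_mem_unitaryGroup (t • L)) hS₀) h
  rw [hcard] at hsum
  rw [phaseSpacingAverage, spacingMean, evolution, hsum]

theorem continuous_onTorus_of_periodic {f : (Fin B → ℝ) → ℝ} (hf : Continuous f)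
    (hper : ∀ x b, f (x + Pi.single b (2 * Real.pi)) = f x) : Continuous (onTorus f) :=
  (continuous_onTorus (X := Unit) (F := fun _ => f) (hf.comp continuous_fst)
    (fun _ => hper)).comp (Continuous.prodMk_right ())

theorem integrable_torus {f : UnitAddTorus (Fin B) → ℝ} (hf : Continuous f) : Integrable f :=
  hf.integrable_of_hasCompactSupport (HasCompactSupport.of_compactSpace _)

/-- The torus average of the mean of `h` over the eigenphase spacings, as a functional of `h`. -/
theorem IsPhaseFamily.exists_phase_functional (hθ : IsPhaseFamily θ) (hB : 1 ≤ B) :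
    ∃ Φ : C(ℝ, ℝ) →L[ℝ] ℝ, (∀ h, Φ h = ∫ τ, onTorus (spacingMean θ h) τ) ∧
      ∀ h C, (∀ s ∈ Set.Icc 0 (2 * Real.pi), |h s| ≤ C) → |Φ h| ≤ C := by
  have hintegrable : ∀ h : C(ℝ, ℝ), Integrable (onTorus (spacingMean θ h)) := fun h =>
    integrable_torus (continuous_onTorus_of_periodic (hθ.continuous_spacingMean h.continuous)
      (hθ.spacingMean_add_single h))
  -- The functional is already given by an integral, so the limit is taken along a one-point filter.
  refine exists_continuousLinearMap_of_tendsto (l := pure ())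
    (M := fun _ h => ∫ τ, onTorus (spacingMean θ h) τ) isCompact_Icc
    (fun h => tendsto_const_nhds) (fun _ g h => ?_) (fun _ a h => ?_) (fun h C hC => ?_)
  · rw [← integral_add (hintegrable g) (hintegrable h)]
    congr 1
    funext τ
    simp only [onTorus, spacingMean, ContinuousMap.add_apply, Finset.sum_add_distrib, mul_add]
  · rw [← integral_const_mul]
    congr 1
    funext τ
    simp only [onTorus, spacingMean, ContinuousMap.smul_apply, smul_eq_mul, ← Finset.mul_sum]
    ring
  · refine Eventually.of_forall fun _ => ?_
    have := norm_integral_le_of_norm_le_const (μ := (volume : Measure (UnitAddTorus (Fin B))))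
      (f := onTorus (spacingMean θ h)) (C := C)
      (Eventually.of_forall fun τ => hθ.abs_spacingMean_le hB hC _)
    simpa using this

theorem meanLength_pos (hB : 1 ≤ B) {L : Fin B → ℝ} (hL : ∀ b, 0 < L b) : 0 < meanLength L :=
  div_pos (sum_pos_of_forall_pos hB hL) (by exact_mod_cast (by omega : 0 < B))

theorem IsPhaseFamily.spacing_mem (hθ : IsPhaseFamily θ) (hB : 1 ≤ B) {L : Fin B → ℝ} {a c : ℝ}
    (ha : 0 < a) (hac : a ≤ c) (haL : ∀ b, a ≤ L b) (hcL : ∀ b, L b ≤ c) (x : Fin B → ℝ) (n : ℤ) :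
    meanLength L * (crossing θ x L n - crossing θ x L (n - 1)) ∈
      Set.Icc 0 (meanLength L * (2 * Real.pi / a)) := by
  have hL : ∀ b, 0 < L b := fun b => ha.trans_le (haL b)
  have hm := meanLength_pos hB hL
  have h1 := hθ.crossing_mono hB hL x (show n - 1 ≤ n by omega)
  have h2 := (hθ.crossing_add_period hB ha hac haL hcL x (n - 1)).2
  have h3 := hθ.crossing_mono hB hL x (show n ≤ n - 1 + (2 * B : ℕ) by omega)
  exact ⟨mul_nonneg hm.le (by linarith), mul_le_mul_of_nonneg_left (by linarith) hm.le⟩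

theorem IsPhaseFamily.exists_abs_spacingValue_le (hθ : IsPhaseFamily θ) (hB : 1 ≤ B)
    {L : Fin B → ℝ} (hL : ∀ b, 0 < L b) {h : ℝ → ℝ} (hh : Continuous h) (x : Fin B → ℝ) :
    ∃ M, ∀ n, |spacingValue θ h x L n| ≤ M := by
  obtain ⟨a, c, ha, hac, haL, hcL⟩ := exists_bounds hB hL
  obtain ⟨M, hM⟩ := (isCompact_Icc (a := 0) (b := meanLength L * (2 * Real.pi / a))).bddAbove_image
    hh.abs.continuousOn
  exact ⟨M, fun n => hM ⟨_, hθ.spacing_mem hB ha hac haL hcL x n, rfl⟩⟩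

theorem IsPhaseFamily.exists_abs_integral_flux_sub_sum_le (hθ : IsPhaseFamily θ) (hB : 1 ≤ B)
    {L : Fin B → ℝ} (hL : ∀ b, 0 < L b) {h : ℝ → ℝ} (hh : Continuous h) (x : Fin B → ℝ) (n₀ : ℤ) :
    ∃ C : ℝ, ∀ N : ℕ, |(∫ t in crossing θ x L n₀..crossing θ x L (n₀ + N),
      flux θ h (x + t • L) L) - ∑ n ∈ Finset.Icc 1 N, spacingValue θ h x L (n₀ + n)| ≤ C := by
  obtain ⟨a, c, ha, hac, haL, hcL⟩ := exists_bounds hB hL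
  obtain ⟨M, hM⟩ := hθ.exists_abs_spacingValue_le hB hL hh x
  have hc : 0 < 2 * Real.pi / c := div_pos Real.two_pi_pos (ha.trans_le hac)
  obtain ⟨C, hC⟩ := exists_abs_integral_tent_sub_sum_le
    (ζ := fun n => crossing θ x L (n₀ + n)) (w := fun n => spacingValue θ h x L (n₀ + n))
    (m := 2 * B) (M := M) (fun i j hij => hθ.crossing_mono hB hL x (by omega)) hc
    (fun n => by
      rw [← add_assoc]
      exact (hθ.crossing_add_period hB ha hac haL hcL x (n₀ + n)).1)
    (fun n => hM _)
  refine ⟨C, fun N => ?_⟩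
  have h1 := hC N
  simp only [add_zero] at h1
  have h2 : ∀ t, ∑ᶠ n : ℤ, tent (crossing θ x L (n₀ + n) - t) * spacingValue θ h x L (n₀ + n) =
      flux θ h (x + t • L) L := by
    intro t
    rw [hθ.flux_add_smul hB hL]
    exact finsum_comp_equiv (Equiv.addLeft n₀)
      (f := fun n => tent (crossing θ x L n - t) * spacingValue θ h x L n)
  simpa only [h2] using h1

theorem IsPhaseFamily.continuous_flux_left (hθ : IsPhaseFamily θ) (hB : 1 ≤ B) {L : Fin B → ℝ}
    (hL : ∀ b, 0 < L b) {h : ℝ → ℝ} (hh : Continuous h) : Continuous fun x => flux θ h x L :=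
  (hθ.continuous_flux hB hh).comp (Continuous.prodMk_left (⟨L, hL⟩ : PositiveLengths B))

theorem IsPhaseFamily.tendsto_crossing_div (hθ : IsPhaseFamily θ) (hB : 1 ≤ B) {L : Fin B → ℝ}
    (hL : ∀ b, 0 < L b) (x : Fin B → ℝ) (n₀ : ℤ) :
    Tendsto (fun N : ℕ => (1 / (N : ℝ)) * crossing θ x L (n₀ + N)) atTop
      (𝓝 (Real.pi / ∑ b, L b)) := by
  obtain ⟨C, hC⟩ := hθ.exists_abs_crossing_sub_le hB hL x
  have hs := sum_pos_of_forall_pos hB hL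
  refine tendsto_div_of_abs_sub_le (A := fun N => Real.pi / (∑ b, L b) * N)
    (C := (C + Real.pi * |(n₀ : ℝ)|) / ∑ b, L b) (fun N => ?_) ?_
  · rw [le_div_iff₀ hs, ← abs_of_pos hs, ← abs_mul, abs_of_pos hs, sub_mul,
      show Real.pi / (∑ b, L b) * N * ∑ b, L b = Real.pi * N by field_simp]
    have h1 := hC (n₀ + N)
    push_cast at h1
    rw [abs_le] at h1 ⊢
    have h2 : |Real.pi * (n₀ : ℝ)| = Real.pi * |(n₀ : ℝ)| := by
      rw [abs_mul, abs_of_pos Real.pi_pos]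
    have h3 := abs_le.1 h2.le
    constructor <;> linarith [h1.1, h1.2, h3.1, h3.2]
  · refine tendsto_const_nhds.congr' ?_
    filter_upwards [eventually_gt_atTop 0] with N hN
    have : (N : ℝ) ≠ 0 := by exact_mod_cast hN.ne'
    field_simp

/-- The limit of the level spacing means, for the enumeration of the spectrum by crossings. -/
theorem IsPhaseFamily.tendsto_spacingValue_mean (hθ : IsPhaseFamily θ) (hB : 1 ≤ B)
    {L : Fin B → ℝ} (hL : ∀ b, 0 < L b) (hLQ : LinearIndependent ℚ L) {h : ℝ → ℝ}
    (hh : Continuous h) (n₀ : ℤ) :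
    Tendsto (fun N : ℕ => (1 / (N : ℝ)) * ∑ n ∈ Finset.Icc 1 N, spacingValue θ h 0 L (n₀ + n))
      atTop (𝓝 (Real.pi / (∑ b, L b) * ∫ τ, onTorus (fun x => flux θ h x L) τ)) := by
  obtain ⟨C, hC⟩ := hθ.exists_abs_integral_flux_sub_sum_le hB hL hh 0 n₀
  simp only [zero_add] at hC
  have hcont : Continuous fun t : ℝ => flux θ h (t • L) L :=
    (hθ.continuous_flux_left hB hL hh).comp (by fun_prop)
  have hii : ∀ a b, IntervalIntegrable (fun t : ℝ => flux θ h (t • L) L) volume a b :=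
    fun a b => hcont.intervalIntegrable a b
  have hz := hθ.tendsto_crossing_div hB hL 0 n₀
  have hs := sum_pos_of_forall_pos hB hL
  have hatTop : Tendsto (fun N : ℕ => crossing θ 0 L (n₀ + N)) atTop atTop := by
    have h1 := hz.pos_mul_atTop (div_pos Real.pi_pos hs) tendsto_natCast_atTop_atTop
    refine h1.congr' ?_
    filter_upwards [eventually_gt_atTop 0] with N hN
    have : (N : ℝ) ≠ 0 := by exact_mod_cast hN.ne'
    field_simp
  have havg := (tendsto_average_of_periodic hLQ (hθ.continuous_flux_left hB hL hh)
    (fun x b => hθ.flux_add_single hB hL h x b)).comp hatTop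
  refine tendsto_div_of_abs_sub_le
    (A := fun N => ∫ t in (0 : ℝ)..crossing θ 0 L (n₀ + N), flux θ h (t • L) L)
    (C := C + |∫ t in (0 : ℝ)..crossing θ 0 L n₀, flux θ h (t • L) L|) (fun N => ?_) ?_
  · have h1 := hC N
    rw [← intervalIntegral.integral_interval_sub_left (hii 0 _) (hii 0 _)] at h1
    rw [abs_le] at h1 ⊢
    have h2 := neg_abs_le (∫ t in (0 : ℝ)..crossing θ 0 L n₀, flux θ h (t • L) L)
    have h3 := le_abs_self (∫ t in (0 : ℝ)..crossing θ 0 L n₀, flux θ h (t • L) L)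
    constructor <;> linarith [h1.1, h1.2]
  -- Factor `(1/N) ∫` as (last crossing time)`/N` times the time average of the flux.
  · refine (hz.mul havg).congr' ?_
    filter_upwards [hatTop.eventually_gt_atTop 0] with N hN
    simp only [Function.comp_apply]
    field_simp

end Functionals

/-! ### Equal bond lengths, and continuity of the level functional there. -/

section EqualLengths

variable {B : ℕ} {θ : (Fin B → ℝ) → ℤ → ℝ} {S₀ : Matrix (Fin B ⊕ Fin B) (Fin B ⊕ Fin B) ℂ}

/-- Used to turn a boundary error that is bounded over `q` periods into an exact identity for one
period. -/
theorem eq_of_forall_nat_mul_abs_sub_le {u v C : ℝ} (h : ∀ q : ℕ, |q * u - q * v| ≤ C) : u = v := by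
  by_contra hne
  obtain ⟨q, hq⟩ := exists_nat_gt (C / |u - v|)
  have hpos : 0 < |u - v| := abs_pos.2 (sub_ne_zero.2 hne)
  rw [div_lt_iff₀ hpos] at hq
  have := h q
  rw [← mul_sub, abs_mul, Nat.abs_cast] at this
  linarith

theorem meanLength_const (hB : 1 ≤ B) (l : ℝ) : meanLength (fun _ : Fin B => l) = l := by
  have : (B : ℝ) ≠ 0 := by exact_mod_cast (by omega : B ≠ 0)
  simp [meanLength, this]

/-- All phases move with speed `l`, so the crossing times are `-θ x (-n) / l` and the scaling by the
mean length `l` leaves an eigenphase spacing at `x`. -/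
theorem IsPhaseFamily.spacingValue_const (hθ : IsPhaseFamily θ) (hB : 1 ≤ B) {l : ℝ} (hl : 0 < l)
    (h : ℝ → ℝ) (x : Fin B → ℝ) (n : ℤ) :
    spacingValue θ h x (fun _ => l) n = h (θ x (-n + 1) - θ x (-n)) := by
  rw [spacingValue, meanLength_const hB, hθ.crossing_const hB hl, hθ.crossing_const hB hl]
  congr 1
  rw [show -(n - 1) = -n + 1 by ring]
  field_simp
  ring

theorem IsPhaseFamily.sum_spacingValue_const (hθ : IsPhaseFamily θ) (hB : 1 ≤ B) {l : ℝ}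
    (hl : 0 < l) (h : ℝ → ℝ) (x : Fin B → ℝ) (q : ℕ) :
    ∑ n ∈ Finset.Icc 1 (q * (2 * B)), spacingValue θ h x (fun _ => l) (0 + n) =
      q * (2 * B * spacingMean θ h x) := by
  have hB' : (B : ℝ) ≠ 0 := by exact_mod_cast (by omega : B ≠ 0)
  have hmean : 2 * B * spacingMean θ h x =
      ∑ j ∈ Finset.range (2 * B), h (θ x (j + 1) - θ x j) := by
    rw [spacingMean]
    field_simp
  rw [sum_Icc_one_eq_sum_range (fun n : ℕ => spacingValue θ h x (fun _ => l) (0 + n))]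
  simp only [hθ.spacingValue_const hB hl]
  induction q with
  | zero => simp
  | succ q ih =>
    rw [Nat.succ_mul, Finset.sum_range_add, ih]
    push_cast
    rw [add_mul, one_mul, hmean]
    congr 1
    rw [← sum_range_int_shift_of_periodic (f := fun j : ℤ => h (θ x (j + 1) - θ x j))
      (hθ.spacing_periodic h x) (-((q : ℤ) * (2 * B)) - 2 * B), ← Finset.sum_range_reflect]
    refine Finset.sum_congr rfl fun j hj => ?_
    have hj := Finset.mem_range.1 hj
    have e : -(0 + ((q : ℤ) * (2 * B) + ((2 * B - 1 - j : ℕ) : ℤ) + 1)) =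
        (j : ℤ) + (-((q : ℤ) * (2 * B)) - 2 * B) := by
      rw [show ((2 * B - 1 - j : ℕ) : ℤ) = 2 * B - 1 - j by omega]
      ring
    rw [e]

theorem toTorus_const_two_pi : toTorus (fun _ : Fin B => 2 * Real.pi) = 0 := by
  funext b
  rw [toTorus, div_self Real.two_pi_pos.ne']
  exact AddCircle.coe_period 1

/-- For equal bond lengths, the flux through one period is the sum over the eigenphase spacings. -/
theorem IsPhaseFamily.integral_flux_const (hθ : IsPhaseFamily θ) (hB : 1 ≤ B) {l : ℝ}
    (hl : 0 < l) {h : ℝ → ℝ} (hh : Continuous h) (x : Fin B → ℝ) :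
    ∫ t in (0 : ℝ)..2 * Real.pi / l, flux θ h (x + t • fun _ => l) (fun _ => l) =
      2 * B * spacingMean θ h x := by
  have hL : ∀ _ : Fin B, 0 < l := fun _ => hl
  have hcont : Continuous fun t : ℝ => flux θ h (x + t • fun _ => l) (fun _ => l) :=
    (hθ.continuous_flux_left hB hL hh).comp (by fun_prop)
  have hper : Function.Periodic (fun t : ℝ => flux θ h (x + t • fun _ => l) (fun _ => l))
      (2 * Real.pi / l) := by
    intro t
    refine eq_of_toTorus_eq (f := fun x => flux θ h x (fun _ => l))
      (fun x b => hθ.flux_add_single hB hL h x b) ?_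
    have e : x + (t + 2 * Real.pi / l) • (fun _ : Fin B => l) =
        x + t • (fun _ => l) + fun _ => 2 * Real.pi := by
      funext b
      simp only [Pi.add_apply, Pi.smul_apply, smul_eq_mul]
      field_simp
      ring
    rw [e, toTorus_add, toTorus_const_two_pi, add_zero]
  obtain ⟨C, hC⟩ := hθ.exists_abs_integral_flux_sub_sum_le hB hL hh x 0
  refine eq_of_forall_nat_mul_abs_sub_le (C := C) fun q => ?_
  have h1 := hC (q * (2 * B))
  rw [hθ.sum_spacingValue_const hB hl] at h1
  -- Here `2B` crossings take exactly one period `2π / l` of the flow.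
  have hend : crossing θ x (fun _ => l) (0 + (q * (2 * B) : ℕ)) =
      crossing θ x (fun _ => l) 0 + (q : ℤ) • (2 * Real.pi / l) := by
    rw [hθ.crossing_const hB hl, hθ.crossing_const hB hl]
    have := quasiperiodic_mul (hθ.period x) 0 (-q : ℤ)
    rw [show (0 : ℤ) + (-q : ℤ) * (2 * B : ℕ) = -(0 + ((q * (2 * B) : ℕ) : ℤ)) by push_cast; ring]
      at this
    rw [this]
    simp only [neg_zero, zsmul_eq_mul]
    push_cast
    field_simp
    ring
  rw [hend, hper.intervalIntegral_add_zsmul_eq q _ (fun a b => hcont.intervalIntegrable a b),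
    hper.intervalIntegral_add_eq _ 0, zero_add, zsmul_eq_mul] at h1
  exact_mod_cast h1

/-- Equidistribution is replaced by invariance of the measure: integrate the translated flux over
one closed orbit and over the torus, in both orders. This gives `(2π / l) ∫ flux = 2B ∫
spacingMean`. -/
theorem IsPhaseFamily.integral_onTorus_flux_const (hθ : IsPhaseFamily θ) (hB : 1 ≤ B) {l : ℝ}
    (hl : 0 < l) {h : ℝ → ℝ} (hh : Continuous h) :
    Real.pi / (∑ _b : Fin B, l) * ∫ τ, onTorus (fun x => flux θ h x (fun _ => l)) τ =
      ∫ τ, onTorus (spacingMean θ h) τ := by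
  have hL : ∀ _ : Fin B, 0 < l := fun _ => hl
  have hT : 0 < 2 * Real.pi / l := div_pos Real.two_pi_pos hl
  have hB' : (0 : ℝ) < B := by exact_mod_cast hB
  set g : UnitAddTorus (Fin B) → ℝ := onTorus (fun x => flux θ h x (fun _ => l)) with hg
  have hper : ∀ x b, flux θ h (x + Pi.single b (2 * Real.pi)) (fun _ => l) =
      flux θ h x (fun _ => l) := fun x b => hθ.flux_add_single hB hL h x b
  have hgc : Continuous g := continuous_onTorus_of_periodic (hθ.continuous_flux_left hB hL hh) hper
  have hflow : Continuous fun p : ℝ × UnitAddTorus (Fin B) =>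
      g (toTorus (p.1 • fun _ => l) + p.2) :=
    hgc.comp ((continuous_toTorus.comp (by fun_prop)).add continuous_snd)
  have hswap := intervalIntegral_integral_swap (μ := (volume : Measure (UnitAddTorus (Fin B))))
    (a := 0) (b := 2 * Real.pi / l) (f := fun t τ => g (toTorus (t • fun _ => l) + τ)) (by
      rw [← Measure.restrict_univ (μ := (volume : Measure (UnitAddTorus (Fin B)))),
        Measure.prod_restrict]
      exact (hflow.continuousOn.integrableOn_compact
        (isCompact_uIcc.prod isCompact_univ)).mono_set
          (Set.prod_mono Set.uIoc_subset_uIcc le_rfl))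
  have hleft : ∀ t : ℝ, ∫ τ, g (toTorus (t • fun _ => l) + τ) = ∫ τ, g τ := fun t =>
    integral_add_left_eq_self g _
  have hright : ∀ τ, ∫ t in (0 : ℝ)..2 * Real.pi / l, g (toTorus (t • fun _ => l) + τ) =
      2 * B * onTorus (spacingMean θ h) τ := by
    intro τ
    obtain ⟨x, rfl⟩ := (isOpenQuotientMap_toTorus (B := B)).surjective τ
    rw [onTorus_toTorus (hθ.spacingMean_add_single h), ← hθ.integral_flux_const hB hl hh x]
    refine intervalIntegral.integral_congr fun t _ => ?_
    rw [add_comm, ← toTorus_add, hg, onTorus_toTorus hper]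
  simp only [hleft, hright, intervalIntegral.integral_const, smul_eq_mul, sub_zero] at hswap
  rw [integral_const_mul] at hswap
  simp only [Finset.sum_const, Finset.card_univ, Fintype.card_fin, nsmul_eq_mul]
  field_simp at hswap ⊢
  linarith

theorem isOpen_positiveLengths : IsOpen {L : Fin B → ℝ | ∀ b, 0 < L b} := by
  have : {L : Fin B → ℝ | ∀ b, 0 < L b} = ⋂ b, {L | 0 < L b} := by
    ext L
    simp
  rw [this]
  exact isOpen_iInter_of_finite fun b => isOpen_lt continuous_const (continuous_apply b)

theorem IsPhaseFamily.continuousOn_integral_flux (hθ : IsPhaseFamily θ) (hB : 1 ≤ B) {h : ℝ → ℝ}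
    (hh : Continuous h) :
    ContinuousOn (fun L : Fin B → ℝ =>
      Real.pi / (∑ b, L b) * ∫ τ, onTorus (fun x => flux θ h x L) τ) {L | ∀ b, 0 < L b} := by
  refine ContinuousOn.mul (ContinuousOn.div continuousOn_const (by fun_prop)
    fun L hL => (sum_pos_of_forall_pos hB hL).ne') ?_
  rw [continuousOn_iff_continuous_domRestrict]
  have : LocallyCompactSpace (PositiveLengths B) := isOpen_positiveLengths.locallyCompactSpace
  have hc := continuous_onTorus (X := PositiveLengths B) (F := fun L x => flux θ h x L.1)
    (hθ.continuous_flux hB hh) (fun L x b => hθ.flux_add_single hB L.2 h x b)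
  have := continuous_parametric_integral_of_continuous
    (μ := (volume : Measure (UnitAddTorus (Fin B))))
    (f := fun (L : PositiveLengths B) τ => onTorus (fun x => flux θ h x L.1) τ) hc isCompact_univ
  simp only [Measure.restrict_univ] at this
  exact this

/-- The level spacing functional for an admissible vector of bond lengths. -/
theorem IsPhaseFamily.exists_level_functional (hθ : IsPhaseFamily θ) (hB : 1 ≤ B)
    (hlift : ∀ x, IsPhaseLift (expDiag x * S₀) (θ x)) {L : Fin B → ℝ}
    (hLadm : L ∈ admissibleLengths B) :
    ∃ Φ : C(ℝ, ℝ) →L[ℝ] ℝ,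
      (∀ h, Φ h = Real.pi / (∑ b, L b) * ∫ τ, onTorus (fun x => flux θ h x L) τ) ∧
      (∃ lam, IsLambdaSpectrum S₀ L lam) ∧
      (∀ lam, IsLambdaSpectrum S₀ L lam → ∀ h : C(ℝ, ℝ),
        Tendsto (fun N : ℕ => levelSpacingMean L lam h N) atTop (𝓝 (Φ h))) ∧
      ∀ (h : C(ℝ, ℝ)) (M : ℝ), (∀ s, |h s| ≤ M) → |Φ h| ≤ M := by
  obtain ⟨hL, hLQ⟩ := hLadm
  obtain ⟨a, c, ha, hac, haL, hcL⟩ := exists_bounds hB hL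
  obtain ⟨n₀, hn₀, hn₁⟩ := hθ.exists_first_positive_crossing hB hL 0
  have hspec := hθ.isLambdaSpectrum hB hlift hL hn₀ hn₁
  have hlim := fun h : C(ℝ, ℝ) => hθ.tendsto_spacingValue_mean hB hL hLQ h.continuous n₀
  obtain ⟨Φ, hΦ, hΦb⟩ := exists_continuousLinearMap_of_tendsto
    (isCompact_Icc (a := 0) (b := meanLength L * (2 * Real.pi / a))) hlim
    (fun N g h => by
      simp only [spacingValue, ContinuousMap.add_apply, Finset.sum_add_distrib, mul_add])
    (fun N r h => by
      simp only [spacingValue, ContinuousMap.smul_apply, smul_eq_mul, ← Finset.mul_sum]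
      ring)
    (fun h C hC => by
      filter_upwards [eventually_gt_atTop 0] with N hN
      have hN' : (0 : ℝ) < N := by exact_mod_cast hN
      rw [abs_mul, abs_of_nonneg (by positivity), one_div, inv_mul_le_iff₀ hN']
      refine (Finset.abs_sum_le_sum_abs _ _).trans ((Finset.sum_le_sum fun (n : ℕ) _ =>
        hC _ (hθ.spacing_mem hB ha hac haL hcL 0 (n₀ + n))).trans ?_)
      simp)
  refine ⟨Φ, hΦ, ⟨_, hspec⟩, fun lam hlam h => ?_, fun h M hM => hΦb h M fun s _ => hM s⟩
  have heq := hlam.unique hspec (hθ.analyticOrderAt_secular_ne_top hB hlift hL)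
  rw [hΦ]
  -- The enumerations agree from index `1` on, so only the term `n = 1`, which contains the free
  -- value `lam 0`, can differ.
  set d : ℕ → ℝ := fun n => h (meanLength L * (lam n - lam (n - 1))) -
    spacingValue θ h 0 L (n₀ + n) with hd
  refine tendsto_div_of_abs_sub_le (C := |d 1|) (fun N => ?_) (hlim h)
  rw [← Finset.sum_sub_distrib]
  have hzero : ∀ n, 2 ≤ n → d n = 0 := by
    intro n hn
    rw [hd]
    simp only
    rw [heq n (by omega), heq (n - 1) (by omega), spacingValue,
      show n₀ + ((n - 1 : ℕ) : ℤ) = n₀ + n - 1 by omega, sub_self]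
  change |∑ n ∈ Finset.Icc 1 N, d n| ≤ |d 1|
  rcases Nat.eq_zero_or_pos N with rfl | hN
  · simp
  · rw [Finset.sum_eq_single_of_mem 1 (Finset.mem_Icc.2 ⟨le_rfl, hN⟩)]
    intro n hn hn1
    rw [Finset.mem_Icc] at hn
    exact hzero n (by omega)

end EqualLengths

end QuantumGraph

end

/-! ### The main theorem. -/

theorem theorem1 {B : ℕ} (hB : 1 ≤ B)
    (S₀ : Matrix (Fin B ⊕ Fin B) (Fin B ⊕ Fin B) ℂ)
    (hS₀ : S₀ ∈ Matrix.unitaryGroup (Fin B ⊕ Fin B) ℂ) :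
    -- the functionals on continuous functions, for each vector of bond lengths;
    -- `C(ℝ, ℝ)` carries the topology of uniform convergence on compact sets
    ∃ Plam Ptheta : (Fin B → ℝ) → (C(ℝ, ℝ) →L[ℝ] ℝ),
      (∀ L ∈ QuantumGraph.admissibleLengths B,
        -- the positive `λ`-spectrum is an infinite sequence
        (∃ lam : ℕ → ℝ, QuantumGraph.IsLambdaSpectrum S₀ L lam) ∧
        -- the level spacing limit exists
        (∀ lam : ℕ → ℝ, QuantumGraph.IsLambdaSpectrum S₀ L lam → ∀ h : C(ℝ, ℝ),
          Tendsto (fun N : ℕ => QuantumGraph.levelSpacingMean L lam h N) atTop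
            (𝓝 (Plam L h))) ∧
        -- the eigenphase spacing limit exists
        (∀ h : C(ℝ, ℝ),
          (∀ Λ : ℝ, IntervalIntegrable (QuantumGraph.phaseSpacingAverage S₀ L h) volume 0 Λ) ∧
          Tendsto
            (fun Λ : ℝ => (1 / Λ) * ∫ t in (0 : ℝ)..Λ, QuantumGraph.phaseSpacingAverage S₀ L h t)
            atTop (𝓝 (Ptheta L h))) ∧
        -- both functionals are bounded, also for the supremum norm
        (∀ (h : C(ℝ, ℝ)) (M : ℝ), (∀ s, |h s| ≤ M) → |Plam L h| ≤ M ∧ |Ptheta L h| ≤ M)) ∧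
      -- they have the same limit as `L → ℓ₀ (1, …, 1)` within the admissible lengths
      (∀ ℓ₀ : ℝ, 0 < ℓ₀ → ∀ h : C(ℝ, ℝ), ∃ p : ℝ,
        Tendsto (fun L => Plam L h)
          (𝓝[QuantumGraph.admissibleLengths B] (fun _ => ℓ₀)) (𝓝 p) ∧
        Tendsto (fun L => Ptheta L h)
          (𝓝[QuantumGraph.admissibleLengths B] (fun _ => ℓ₀)) (𝓝 p)) := by
  classical
  obtain ⟨θ, hlift, hθ⟩ := QuantumGraph.exists_isPhaseFamily hB hS₀
  obtain ⟨Ψ, hΨ, hΨb⟩ := hθ.exists_phase_functional hB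
  choose Φ hΦ hspec hlim hΦb using
    fun L : QuantumGraph.admissibleLengths B => hθ.exists_level_functional hB hlift L.2
  -- The eigenphase functional is the same `Ψ` for every `L`. The value `0` off the admissible set
  -- is invisible to the limit, which is taken within that set.
  refine ⟨fun L => if hL : L ∈ QuantumGraph.admissibleLengths B then Φ ⟨L, hL⟩ else 0,
    fun _ => Ψ, fun L hL => ?_, fun l hl h => ⟨Ψ h, ?_, tendsto_const_nhds⟩⟩
  · simp only [dif_pos hL]
    refine ⟨hspec ⟨L, hL⟩, hlim ⟨L, hL⟩, fun h => ?_, fun h M hM =>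
      ⟨hΦb ⟨L, hL⟩ h M hM, hΨb h M fun s _ => hM s⟩⟩
    have heq : QuantumGraph.phaseSpacingAverage S₀ L h =
        fun t : ℝ => QuantumGraph.spacingMean θ h (t • L) :=
      funext fun t => QuantumGraph.phaseSpacingAverage_eq hB hS₀ hlift L h t
    rw [heq]
    refine ⟨fun Λ => Continuous.intervalIntegrable
      ((hθ.continuous_spacingMean h.continuous).comp (by fun_prop)) _ _, ?_⟩
    rw [hΨ]
    exact QuantumGraph.tendsto_average_of_periodic hL.2 (hθ.continuous_spacingMean h.continuous)
      (hθ.spacingMean_add_single h)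
  -- The target is now the level formula at equal lengths, and the limit is its continuity at that
  -- point.
  · rw [hΨ, ← hθ.integral_onTorus_flux_const hB hl h.continuous]
    have hcont := (hθ.continuousOn_integral_flux hB h.continuous (fun _ => l)
      (fun _ => hl)).mono (fun L (hL : L ∈ QuantumGraph.admissibleLengths B) => hL.1)
    refine Tendsto.congr' ?_ hcont
    filter_upwards [self_mem_nhdsWithin] with L hL
    rw [dif_pos hL, hΦ]
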